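/- Let $d\ge 1$ be an integer and let $p\ge 2$ be real. Let $W^{1,p}_O(\mathbb{R}^d)$ be the space of all real-valued $u\in W^{1,p}(\mathbb{R}^d)$ that are odd, i.e. $u(-x)=-u(x)$ for almost every $x\in\mathbb{R}^d$. Then for every $u\in W^{1,p}_O(\mathbb{R}^d)$, with weak gradient $\nabla u$ and Euclidean norm $|\cdot|$, the function $|u(x)|^p/|x|^p$ is integrable on $\mathbb{R}^d$ and $$ \int_{\mathbb{R}^d}|\nabla u(x)|^p\,dx\;\ge\; D_H(d,p)\int_{\mathbb{R}^d}\frac{|u(x)|^p}{|x|^p}\,dx , \qquad D_H(d,p)=\left(\frac{4(p-2)}{p^2}+\left(\frac{d-p+2}{p}\right)^2\right)^{p/2}. $$ -/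

import Mathlib

open MeasureTheory

/-- `G = (G₁, …, G_d)` is the weak (distributional) gradient of `u : ℝ^d → ℝ`: both are locally
integrable and `∫ u ∂ᵢφ = - ∫ Gᵢ φ` for every coordinate `i` and every test function
`φ ∈ C_c^∞(ℝ^d)`. -/
structure HasWeakGradient {d : ℕ} (u : EuclideanSpace ℝ (Fin d) → ℝ)
    (G : EuclideanSpace ℝ (Fin d) → EuclideanSpace ℝ (Fin d)) : Prop where
  locallyIntegrable : LocallyIntegrable u volume
  locallyIntegrable_gradient : LocallyIntegrable G volume
  integral_eq : ∀ (φ : EuclideanSpace ℝ (Fin d) → ℝ),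
    ContDiff ℝ (⊤ : ℕ∞) φ → HasCompactSupport φ → ∀ i : Fin d,
      ∫ x, u x * fderiv ℝ φ x (EuclideanSpace.single i 1) = - ∫ x, G x i * φ x

/-- The Sobolev space `W^{1,p}(ℝ^d)`: `u` lies in `L^p` and has a weak gradient in `L^p`. -/
def MemSobolevW1 {d : ℕ} (p : ℝ) (u : EuclideanSpace ℝ (Fin d) → ℝ) : Prop :=
  MemLp u (ENNReal.ofReal p) volume ∧
    ∃ G : EuclideanSpace ℝ (Fin d) → EuclideanSpace ℝ (Fin d),
      HasWeakGradient u G ∧ MemLp G (ENNReal.ofReal p) volume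

/-- The odd Sobolev space `W^{1,p}_O(ℝ^d)`. Elements of `W^{1,p}` are functions up to almost
everywhere equality, so oddness is `u(-x) = -u(x)` for almost every `x`. -/
def MemOddSobolevW1 {d : ℕ} (p : ℝ) (u : EuclideanSpace ℝ (Fin d) → ℝ) : Prop :=
  MemSobolevW1 p u ∧ ∀ᵐ x ∂(volume : Measure (EuclideanSpace ℝ (Fin d))), u (-x) = - u x

/-- The constant `D_H(d,p) = (4(p-2)/p² + ((d-p+2)/p)²)^{p/2}`. -/
noncomputable def hardyConstOdd (d : ℕ) (p : ℝ) : ℝ :=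
  (4 * (p - 2) / p ^ 2 + (((d : ℝ) - p + 2) / p) ^ 2) ^ (p / 2)

/-! Put v = sgn(u)|u|^(p/2), so that |∇v|² = (p/2)²|u|^(p-2)|∇u|². A weighted L² Hardy inequality
for v then reads C ∫ |u|^p/|x|^p ≤ ∫ (p/2)² (|u|/|x|)^(p-2) |∇u|² with C = ((d-p)/2)² + (d-1); this
is `quadratic_hardy_odd`. The radial derivative contributes ((d-p)/2)², by a Hardy inequality on
each ray (`radial_hardy_lintegral`). The tangential derivative contributes d-1, the Poincaré
constant for odd functions on the unit sphere (`sphere_poincare_odd`). Pointwise Young with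
parameter m = 4C/p² turns the right side into ∫ |∇u|^p plus a multiple of ∫ |u|^p/|x|^p that is
absorbed on the left; what remains has constant m^(p/2) = D_H.

The sphere inequality is reduced to great circles. An odd function vanishes at two antipodal points
of each great circle, so Wirtinger's inequality applies on the half circles between them. To average
over circles, take independent standard Gaussian vectors x, y: rotating the pair (x, y) preserves
its law, while the direction of the first component runs along a great circle. That component traces
an ellipse, hence the weight in `wirtinger_ellipse`. Averaging over y for fixed x produces the
factor d-1 on one side and the squared tangential gradient on the other.

A general odd Sobolev function is mollified by an even kernel, which keeps it odd, and cut off;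
Fatou's lemma on the Hardy side passes to the limit. -/

/-! ### Polar coordinates and Gaussian directions -/

section Polar

open Set Metric Module ProbabilityTheory
open scoped ENNReal

variable {E : Type*} [NormedAddCommGroup E] [InnerProductSpace ℝ E] [FiniteDimensional ℝ E]
  [MeasurableSpace E] [BorelSpace E]

/-- Integration in polar coordinates for nonnegative functions. -/
theorem lintegral_eq_lintegral_toSphere [Nontrivial E] {F : E → ℝ≥0∞} (hF : Measurable F) :
    ∫⁻ x, F x = ∫⁻ ω : sphere (0 : E) 1, (∫⁻ r in Ioi (0 : ℝ),
      ENNReal.ofReal (r ^ (finrank ℝ E - 1)) * F (r • (ω : E)))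
        ∂(volume : Measure E).toSphere := by
  have hmp := (volume : Measure E).measurePreserving_homeomorphUnitSphereProd
  have hmeas : Measurable fun q : sphere (0 : E) 1 × Ioi (0 : ℝ) ↦ F ((q.2 : ℝ) • (q.1 : E)) := by
    fun_prop
  calc ∫⁻ x, F x = ∫⁻ x in ({0}ᶜ : Set E), F x := by rw [restrict_compl_singleton]
    _ = ∫⁻ x : ({0}ᶜ : Set E), F x ∂((volume : Measure E).comap (↑)) := by
      rw [lintegral_subtype_comap (measurableSet_singleton _).compl]
    _ = ∫⁻ q, F ((q.2 : ℝ) • (q.1 : E))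
          ∂((volume : Measure E).toSphere.prod (.volumeIoiPow (finrank ℝ E - 1))) := by
      rw [← hmp.lintegral_comp hmeas]
      refine lintegral_congr fun x ↦ ?_
      have hx : ‖(x : E)‖ ≠ 0 := norm_ne_zero_iff.2 x.2
      simp [smul_smul, hx]
    _ = _ := by
      rw [lintegral_prod _ hmeas.aemeasurable]
      refine lintegral_congr fun ω ↦ ?_
      rw [Measure.volumeIoiPow, lintegral_withDensity_eq_lintegral_mul _ (by fun_prop) (by fun_prop)]
      exact lintegral_subtype_comap measurableSet_Ioi
        (fun r : ℝ ↦ ENNReal.ofReal (r ^ (finrank ℝ E - 1)) * F (r • (ω : E)))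

/-- The standard Gaussian measure has a radial density. -/
theorem stdGaussian_eq_withDensity : ∃ c : ℝ, 0 < c ∧ stdGaussian E =
    volume.withDensity fun x : E ↦ ENNReal.ofReal (c * Real.exp (-‖x‖ ^ 2 / 2)) := by
  have hb : 0 < ((1 / 2 : ℂ)).re := by norm_num
  set c : ℝ := ((2 * Real.pi) ^ (finrank ℝ E / 2 : ℝ))⁻¹ with hc
  have hc0 : 0 < c := by positivity
  refine ⟨c, hc0, ?_⟩
  have hint : Integrable fun x : E ↦ Real.exp (-‖x‖ ^ 2 / 2) := by
    have := (GaussianFourier.integrable_cexp_neg_mul_sq_norm_add (V := E) hb 0 0).re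
    refine this.congr (ae_of_all _ fun x ↦ ?_)
    have : (-(1 / 2 : ℂ) * (‖x‖ : ℂ) ^ 2 + 0 * (inner ℝ (0 : E) x : ℝ))
      = ((-‖x‖ ^ 2 / 2 : ℝ) : ℂ) := by push_cast; ring
    simp only [this, ← Complex.ofReal_exp]
    exact Complex.ofReal_re _
  have hfin : IsFiniteMeasure
      (volume.withDensity fun x : E ↦ ENNReal.ofReal (c * Real.exp (-‖x‖ ^ 2 / 2))) :=
    isFiniteMeasure_withDensity_ofReal (hint.const_mul c).2
  apply Measure.ext_of_charFun
  ext t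
  rw [charFun_stdGaussian, charFun_apply]
  have h1 := integral_withDensity_eq_integral_toReal_smul (μ := (volume : Measure E))
    (f := fun x : E ↦ ENNReal.ofReal (c * Real.exp (-‖x‖ ^ 2 / 2))) (by fun_prop) (by simp)
    (fun x ↦ Complex.exp ((inner ℝ x t : ℝ) * Complex.I))
  rw [h1]
  have h2 := GaussianFourier.integral_cexp_neg_mul_sq_norm_add (V := E) hb Complex.I t
  have h3 : ∀ x : E, (ENNReal.ofReal (c * Real.exp (-‖x‖ ^ 2 / 2))).toReal •
      Complex.exp ((inner ℝ x t : ℝ) * Complex.I) = (c : ℂ) *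
        Complex.exp (-(1 / 2 : ℂ) * (‖x‖ : ℂ) ^ 2 + Complex.I * (inner ℝ t x : ℝ)) := by
    intro x
    rw [ENNReal.toReal_ofReal (by positivity), Complex.real_smul, Complex.ofReal_mul,
      Complex.ofReal_exp, mul_assoc, ← Complex.exp_add, real_inner_comm]
    congr 2
    push_cast
    ring
  simp_rw [h3]
  rw [integral_const_mul, h2, ← mul_assoc]
  have h4 : (c : ℂ) * ((Real.pi : ℂ) / (1 / 2)) ^ (finrank ℝ E / 2 : ℂ) = 1 := by
    have : ((Real.pi : ℂ) / (1 / 2)) ^ (finrank ℝ E / 2 : ℂ) =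
        (((2 * Real.pi) ^ (finrank ℝ E / 2 : ℝ) : ℝ) : ℂ) := by
      rw [Complex.ofReal_cpow (by positivity)]
      push_cast
      congr 1
      ring
    rw [this, hc, ← Complex.ofReal_mul, inv_mul_cancel₀ (by positivity), Complex.ofReal_one]
  rw [h4, one_mul]
  congr 1
  rw [Complex.I_sq]
  ring

/-- Up to a constant, Lebesgue measure is obtained by integrating over rays whose direction is that
of a Gaussian vector. -/
theorem exists_lintegral_stdGaussian_ray [Nontrivial E] : ∃ κ : ℝ≥0∞, κ ≠ 0 ∧ κ ≠ ∞ ∧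
    ∀ F : E → ℝ≥0∞, Measurable F →
      ∫⁻ x, (∫⁻ r in Ioi (0 : ℝ),
        ENNReal.ofReal (r ^ (finrank ℝ E - 1)) * F (r • ‖x‖⁻¹ • x)) ∂(stdGaussian E) =
      κ * ∫⁻ x, F x := by
  obtain ⟨c, hc, hγ⟩ := stdGaussian_eq_withDensity (E := E)
  set κ : ℝ≥0∞ := ∫⁻ r in Ioi (0 : ℝ), ENNReal.ofReal (r ^ (finrank ℝ E - 1)) *
    ENNReal.ofReal (c * Real.exp (-r ^ 2 / 2)) with hκ
  -- A function of the direction alone does not see the radius, so the radial integral of the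
  -- Gaussian density factors out as `κ`.
  have key : ∀ H : E → ℝ≥0∞, Measurable H → ∫⁻ x, H (‖x‖⁻¹ • x) ∂(stdGaussian E) =
      κ * ∫⁻ ω : sphere (0 : E) 1, H ω ∂(volume : Measure E).toSphere := by
    intro H hH
    rw [hγ, lintegral_withDensity_eq_lintegral_mul _ (by fun_prop) (by fun_prop),
      lintegral_eq_lintegral_toSphere (by fun_prop), ← lintegral_const_mul _ (by fun_prop)]
    refine lintegral_congr fun ω ↦ ?_
    rw [hκ, ← lintegral_mul_const _ (by fun_prop)]
    refine setLIntegral_congr_fun measurableSet_Ioi fun r hr ↦ ?_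
    have hr : 0 < r := hr
    have hω : ‖(ω : E)‖ = 1 := by simp
    simp only [Pi.mul_apply, norm_smul, hω, mul_one, Real.norm_of_nonneg hr.le, smul_smul,
      inv_mul_cancel₀ hr.ne', one_smul, mul_assoc]
  -- Total mass: 1 = `κ` times the area of the sphere, which excludes both `κ = 0` and `κ = ∞`.
  have h1 := key (fun _ ↦ 1) measurable_const
  simp only [lintegral_const, measure_univ, one_mul] at h1
  refine ⟨κ, ?_, ?_, fun F hF ↦ ?_⟩
  · rintro h
    simp [h] at h1
  · rintro h
    rw [h, ENNReal.top_mul] at h1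
    · simp at h1
    · intro h0
      simp [h0] at h1
  · rw [key (fun y ↦ ∫⁻ r in Ioi (0 : ℝ),
        ENNReal.ofReal (r ^ (finrank ℝ E - 1)) * F (r • y)),
      lintegral_eq_lintegral_toSphere hF]
    exact Measurable.lintegral_prod_right' (f := fun q : E × ℝ ↦
      ENNReal.ofReal (q.2 ^ (finrank ℝ E - 1)) * F (q.2 • q.1)) (by fun_prop)

/-- Second moments of the standard Gaussian measure. -/
theorem lintegral_inner_sq_stdGaussian (b : E) :
    ∫⁻ y, ENNReal.ofReal (inner ℝ b y ^ 2) ∂(stdGaussian E) = ENNReal.ofReal (‖b‖ ^ 2) := by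
  have h := variance_dual_stdGaussian (innerSL ℝ b)
  have hL : MemLp (innerSL ℝ b) 2 (stdGaussian E) := IsGaussian.memLp_dual _ _ _ (by simp)
  rw [variance_of_integral_eq_zero (by fun_prop) (integral_strongDual_stdGaussian _)] at h
  have h' := ofReal_integral_eq_lintegral_ofReal hL.integrable_sq
    (ae_of_all _ fun _ ↦ sq_nonneg _)
  rw [h] at h'
  simpa using h'.symm

theorem lintegral_norm_sq_stdGaussian :
    ∫⁻ y, ENNReal.ofReal (‖y‖ ^ 2) ∂(stdGaussian E) = finrank ℝ E := by
  simp_rw [← (stdOrthonormalBasis ℝ E).sum_sq_inner_right]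
  have : ∀ y : E, ENNReal.ofReal (∑ i, inner ℝ (stdOrthonormalBasis ℝ E i) y ^ 2) =
      ∑ i, ENNReal.ofReal (inner ℝ (stdOrthonormalBasis ℝ E i) y ^ 2) :=
    fun y ↦ ENNReal.ofReal_sum_of_nonneg fun _ _ ↦ sq_nonneg _
  simp_rw [this]
  rw [lintegral_finsetSum _ (by fun_prop)]
  simp [lintegral_inner_sq_stdGaussian]

end Polar

/-! ### Hardy's inequality on a half-line -/

section Radial

open Set Filter Topology

theorem abs_rpow_eq_mul_sq {p : ℝ} (hp : 2 ≤ p) (x : ℝ) : |x| ^ p = |x| ^ (p - 2) * x ^ 2 := by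
  rcases eq_or_ne x 0 with rfl | h0
  · simp [Real.zero_rpow (show p ≠ 0 by linarith)]
  · rw [← sq_abs, ← Real.rpow_natCast |x| 2, ← Real.rpow_add (abs_pos.2 h0)]
    congr 1; push_cast; ring

/-- The weighted Hardy inequality on a half-line. -/
theorem radial_hardy_lintegral {p : ℝ} (hp : 2 ≤ p) {d : ℕ} (hd : 1 ≤ d) {f : ℝ → ℝ}
    (hf : ContDiff ℝ 1 f) (hf0 : f 0 = 0) (hfs : HasCompactSupport f) :
    ∫⁻ r in Ioi (0 : ℝ), ENNReal.ofReal (r ^ (d - 1)) *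
        ENNReal.ofReal (((d - p) / 2) ^ 2 * (|f r| ^ p / r ^ p)) ≤
      ∫⁻ r in Ioi (0 : ℝ), ENNReal.ofReal (r ^ (d - 1)) *
        ENNReal.ofReal ((p / 2) ^ 2 * (|f r| / r) ^ (p - 2) * deriv f r ^ 2) := by
  obtain ⟨L, hL⟩ := hf.lipschitzWith_of_hasCompactSupport hfs (by norm_num)
  have hLf : ∀ r, 0 ≤ r → |f r| ≤ L * r := fun r hr ↦ by
    simpa [hf0, abs_of_nonneg hr] using hL.dist_le_mul r 0
  have hLd : ∀ r, |deriv f r| ≤ L := fun r ↦ by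
    simpa using norm_deriv_le_of_lipschitz (x₀ := r) hL
  obtain ⟨R, hR0, hR⟩ : ∃ R : ℝ, 0 < R ∧ ∀ r, R ≤ r → f r = 0 := by
    obtain ⟨R, hR0, hR⟩ := hfs.isCompact.isBounded.exists_pos_norm_lt
    refine ⟨R, hR0, fun r hr ↦ by_contra fun h ↦ ?_⟩
    have := hR r (subset_tsupport f h)
    rw [Real.norm_of_nonneg (hR0.le.trans hr)] at this
    linarith
  have hd' : ((d - 1 : ℕ) : ℝ) = (d : ℝ) - 1 := by push_cast [Nat.cast_sub hd]; ring
  have hpow : ∀ r : ℝ, 0 < r → r ^ (d - 1) = r ^ ((d : ℝ) - 1) := fun r hr ↦ by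
    rw [← Real.rpow_natCast, hd']
  set a : ℝ := (d - p) / 2 with ha
  set A : ℝ → ℝ := fun r ↦ r ^ (d - 1) * (a ^ 2 * (|f r| ^ p / r ^ p)) with hA
  set B : ℝ → ℝ := fun r ↦ r ^ (d - 1) * ((p / 2) ^ 2 * (|f r| / r) ^ (p - 2) * deriv f r ^ 2)
    with hB
  have hdf : Continuous (deriv f) := hf.continuous_deriv le_rfl
  have hquot : ∀ r, 0 < r → |f r| / r ≤ L := fun r hr ↦ by
    rw [div_le_iff₀ hr]; exact hLf r hr.le
  have hAm : Measurable A := by have := hf.continuous.measurable; fun_prop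
  have hBm : Measurable B := by
    have := hf.continuous.measurable; have := hdf.measurable; fun_prop
  have hA0 : ∀ r, 0 < r → 0 ≤ A r := fun r hr ↦ by positivity
  have hB0 : ∀ r, 0 < r → 0 ≤ B r := fun r hr ↦ by positivity
  have hAb : ∀ r ∈ Ioc 0 R, A r ≤ R ^ (d - 1) * (a ^ 2 * (L : ℝ) ^ p) := fun r hr ↦ by
    have : |f r| ^ p / r ^ p ≤ (L : ℝ) ^ p := by
      rw [← Real.div_rpow (abs_nonneg _) hr.1.le]
      exact Real.rpow_le_rpow (div_nonneg (abs_nonneg _) hr.1.le) (hquot r hr.1) (by linarith)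
    have := hr.1.le
    have := hr.2
    simp only [hA]
    gcongr
  have hBb : ∀ r ∈ Ioc 0 R, B r ≤ R ^ (d - 1) * ((p / 2) ^ 2 * (L : ℝ) ^ (p - 2) * (L : ℝ) ^ 2) :=
    fun r hr ↦ by
    have h1 : (|f r| / r) ^ (p - 2) ≤ (L : ℝ) ^ (p - 2) :=
      Real.rpow_le_rpow (div_nonneg (abs_nonneg _) hr.1.le) (hquot r hr.1) (by linarith)
    have h2 : deriv f r ^ 2 ≤ (L : ℝ) ^ 2 := by
      rw [← sq_abs]; gcongr; exact hLd r
    have := hr.1.le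
    have := hr.2
    simp only [hB]
    gcongr
  have hAi : IntegrableOn A (Ioc 0 R) := by
    refine Measure.integrableOn_of_bounded (M := R ^ (d - 1) * (a ^ 2 * (L : ℝ) ^ p)) (by simp)
      hAm.aestronglyMeasurable ?_
    refine (ae_restrict_mem measurableSet_Ioc).mono fun r hr ↦ ?_
    rw [Real.norm_of_nonneg (hA0 r hr.1)]
    exact hAb r hr
  have hBi : IntegrableOn B (Ioc 0 R) := by
    refine Measure.integrableOn_of_bounded
      (M := R ^ (d - 1) * ((p / 2) ^ 2 * (L : ℝ) ^ (p - 2) * (L : ℝ) ^ 2)) (by simp)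
      hBm.aestronglyMeasurable ?_
    refine (ae_restrict_mem measurableSet_Ioc).mono fun r hr ↦ ?_
    rw [Real.norm_of_nonneg (hB0 r hr.1)]
    exact hBb r hr
  have key : ∫ r in Ioc 0 R, A r ≤ ∫ r in Ioc 0 R, B r := by
    -- Chosen so that B - A - g' = r^(2a-1) |f|^(p-2) (p/2 · r f' + a f)² ≥ 0, where 2a = d - p. As
    -- g vanishes at 0 and at R, integration gives the claim.
    set g : ℝ → ℝ := fun r ↦ -a * (|f r| ^ p * r ^ (2 * a)) with hg
    have hgc : ContinuousOn g (Icc 0 R) := by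
      intro r hr
      rcases hr.1.eq_or_lt with rfl | hr0
      · refine ContinuousWithinAt.mono ?_ Icc_subset_Ici_self
        have hg0 : g 0 = 0 := by
          simp [hg, hf0, Real.zero_rpow (show p ≠ 0 by linarith)]
        rw [ContinuousWithinAt, hg0]
        -- The exponent 2a may be negative; the Lipschitz bound |f r| ≤ L r compensates, since p +
        -- 2a = d ≥ 1.
        have hlim : Tendsto (fun r : ℝ ↦ |a| * (L : ℝ) ^ p * r ^ d) (𝓝[≥] 0) (𝓝 0) := by
          have : Continuous fun r : ℝ ↦ |a| * (L : ℝ) ^ p * r ^ d := by fun_prop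
          have h := this.tendsto 0
          simp only [zero_pow (show d ≠ 0 by omega), mul_zero] at h
          exact h.mono_left nhdsWithin_le_nhds
        refine squeeze_zero_norm' ?_ hlim
        filter_upwards [self_mem_nhdsWithin] with r hr
        rcases (show (0 : ℝ) ≤ r from hr).eq_or_lt with rfl | hr
        · rw [hg0, norm_zero]; positivity
        · have h1 : |f r| ^ p ≤ (L : ℝ) ^ p * r ^ p := by
            rw [← Real.mul_rpow (by positivity) hr.le]
            exact Real.rpow_le_rpow (abs_nonneg _) (hLf r hr.le) (by linarith)
          have h2 : r ^ p * r ^ (2 * a) = r ^ d := by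
            rw [← Real.rpow_add hr, ← Real.rpow_natCast]
            congr 1
            rw [ha]; ring
          simp only [hg, norm_mul, norm_neg, Real.norm_eq_abs]
          rw [abs_of_nonneg (by positivity : 0 ≤ |f r| ^ p), abs_of_nonneg (by positivity :
            0 ≤ r ^ (2 * a)), mul_assoc, ← h2, ← mul_assoc ((L : ℝ) ^ p)]
          gcongr
      · refine ContinuousAt.continuousWithinAt ?_
        have h1 : ContinuousAt (fun r ↦ |f r| ^ p) r :=
          (hf.continuous.abs.continuousAt).rpow_const (Or.inr (by linarith))
        have h2 : ContinuousAt (fun r : ℝ ↦ r ^ (2 * a)) r :=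
          Real.continuousAt_rpow_const _ _ (Or.inl hr0.ne')
        exact continuousAt_const.mul (h1.mul h2)
    have hgd : ∀ r ∈ Ioo 0 R, HasDerivWithinAt g
        (-a * ((p * |f r| ^ (p - 2) * f r * deriv f r) * r ^ (2 * a) +
          |f r| ^ p * (2 * a * r ^ (2 * a - 1)))) (Ioi r) r := by
      intro r hr
      have h1 : HasDerivAt (fun r ↦ |f r| ^ p) (p * |f r| ^ (p - 2) * f r * deriv f r) r :=
        (hasDerivAt_abs_rpow (f r) (by linarith)).comp r
          ((hf.differentiable (by norm_num)) r).hasDerivAt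
      have h2 : HasDerivAt (fun r : ℝ ↦ r ^ (2 * a)) (2 * a * r ^ (2 * a - 1)) r :=
        Real.hasDerivAt_rpow_const (Or.inl hr.1.ne')
      exact ((h1.mul h2).const_mul (-a)).hasDerivWithinAt
    have hgle : ∀ r ∈ Ioo 0 R, -a * ((p * |f r| ^ (p - 2) * f r * deriv f r) * r ^ (2 * a) +
          |f r| ^ p * (2 * a * r ^ (2 * a - 1))) ≤ B r - A r := by
      intro r hr
      have hr0 := hr.1
      have e1 : r ^ (d - 1) = r ^ (2 * a - 1) * r ^ p := by
        rw [hpow r hr0, ← Real.rpow_add hr0]; congr 1; rw [ha]; ring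
      have e2 : r ^ (2 * a) = r ^ (2 * a - 1) * r := by
        rw [← Real.rpow_add_one hr0.ne']; congr 1; ring
      have e3 : r ^ p = r ^ (p - 2) * r ^ 2 := by
        rw [← Real.rpow_natCast r 2, ← Real.rpow_add hr0]; congr 1; push_cast; ring
      have e4 := abs_rpow_eq_mul_sq hp (f r)
      have hx : 0 < r ^ (p - 2) := by positivity
      have hAr : A r = r ^ (2 * a - 1) * |f r| ^ (p - 2) * (a * f r) ^ 2 := by
        simp only [hA]
        rw [e1, e4]
        field_simp
      have hBr : B r = r ^ (2 * a - 1) * |f r| ^ (p - 2) * (p / 2 * (r * deriv f r)) ^ 2 := by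
        simp only [hB]
        rw [e1, e3, Real.div_rpow (abs_nonneg _) hr0.le]
        field_simp
      rw [hAr, hBr, e2, e4]
      have : 0 ≤ r ^ (2 * a - 1) * |f r| ^ (p - 2) *
        (p / 2 * (r * deriv f r) + a * f r) ^ 2 := by positivity
      linarith
    have h := intervalIntegral.sub_le_integral_of_hasDeriv_right_of_le hR0.le hgc hgd
      (φ := fun r ↦ B r - A r) ((integrableOn_Icc_iff_integrableOn_Ioc).2 (hBi.sub hAi)) hgle
    have hgR : g R = 0 := by
      simp [hg, hR R le_rfl, Real.zero_rpow (show p ≠ 0 by linarith)]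
    have hg0 : g 0 = 0 := by
      simp [hg, hf0, Real.zero_rpow (show p ≠ 0 by linarith)]
    rw [hgR, hg0, intervalIntegral.integral_of_le hR0.le, integral_sub hBi hAi] at h
    linarith
  have hAlin : ∫⁻ r in Ioi (0 : ℝ), ENNReal.ofReal (r ^ (d - 1)) *
      ENNReal.ofReal (a ^ 2 * (|f r| ^ p / r ^ p)) =
      ∫⁻ r in Ioc 0 R, ENNReal.ofReal (A r) := by
    rw [← Ioc_union_Ioi_eq_Ioi hR0.le, lintegral_union measurableSet_Ioi
      (Ioc_disjoint_Ioi le_rfl), setLIntegral_congr_fun (g := fun _ ↦ 0) measurableSet_Ioi,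
      lintegral_zero, add_zero]
    · refine setLIntegral_congr_fun measurableSet_Ioc fun r hr ↦ ?_
      rw [← ENNReal.ofReal_mul (pow_nonneg hr.1.le _)]
    · intro r hr
      simp [hR r (le_of_lt hr), Real.zero_rpow (show p ≠ 0 by linarith)]
  calc _ = ∫⁻ r in Ioc 0 R, ENNReal.ofReal (A r) := hAlin
    _ = ENNReal.ofReal (∫ r in Ioc 0 R, A r) :=
      (ofReal_integral_eq_lintegral_ofReal hAi
        ((ae_restrict_mem measurableSet_Ioc).mono fun r hr ↦ hA0 r hr.1)).symm
    _ ≤ ENNReal.ofReal (∫ r in Ioc 0 R, B r) := ENNReal.ofReal_le_ofReal key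
    _ = ∫⁻ r in Ioc 0 R, ENNReal.ofReal (B r) :=
      ofReal_integral_eq_lintegral_ofReal hBi
        ((ae_restrict_mem measurableSet_Ioc).mono fun r hr ↦ hB0 r hr.1)
    _ = ∫⁻ r in Ioc 0 R, ENNReal.ofReal (r ^ (d - 1)) *
        ENNReal.ofReal ((p / 2) ^ 2 * (|f r| / r) ^ (p - 2) * deriv f r ^ 2) :=
      setLIntegral_congr_fun measurableSet_Ioc fun r hr ↦ by
        rw [← ENNReal.ofReal_mul (pow_nonneg hr.1.le _)]
    _ ≤ _ := lintegral_mono_set Ioc_subset_Ioi_self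

end Radial

/-! ### Wirtinger's inequality along an ellipse -/

section Circle

open Set Filter Topology

/-- `F` vanishes to higher order than `S`, so the quotient tends to 0. This is also its value at
`t`, by the convention that division by zero gives 0. -/
theorem continuousAt_div_of_hasDerivAt_zero {F S : ℝ → ℝ} {t σ : ℝ} (hF : HasDerivAt F 0 t)
    (hS : HasDerivAt S σ t) (hF0 : F t = 0) (hS0 : S t = 0) (hσ : σ ≠ 0) :
    ContinuousAt (fun x ↦ F x / S x) t := by
  rw [continuousAt_iff_punctured_nhds, hF0, zero_div]
  have h := (hasDerivAt_iff_tendsto_slope.1 hF).div (hasDerivAt_iff_tendsto_slope.1 hS) hσ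
  rw [zero_div] at h
  refine h.congr' ?_
  filter_upwards [self_mem_nhdsWithin] with x hx
  have hx : x - t ≠ 0 := sub_ne_zero.2 hx
  simp only [Pi.div_apply, slope_def_field, hF0, hS0, sub_zero]
  rw [div_div_div_cancel_right₀ hx]

/-- A weighted Wirtinger inequality on `[0, π]`, whose weight comes from parametrizing
the unit circle by an ellipse. -/
theorem wirtinger_ellipse {p : ℝ} (hp : 2 ≤ p) {α β δ : ℝ}
    {h h' q : ℝ → ℝ} (hh : ∀ t, HasDerivAt h (h' t) t) (hh' : Continuous h') (h0 : h 0 = 0)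
    (hπ : h Real.pi = 0) (hqpos : ∀ t, 0 < q t) (hq : ∀ t,
      q t = α * Real.cos t ^ 2 + 2 * β * (Real.sin t * Real.cos t) + δ * Real.sin t ^ 2) :
    ∫ t in 0..Real.pi, (α * δ - β ^ 2) / q t * |h t| ^ p ≤
      ∫ t in 0..Real.pi, (p / 2) ^ 2 * |h t| ^ (p - 2) * (h' t ^ 2 * q t) := by
  have hc : Continuous h := continuous_iff_continuousAt.2 fun t ↦ (hh t).continuousAt
  have hqc : Continuous q := by
    rw [show q = _ from funext hq]; fun_prop
  have hpc : Continuous fun t ↦ |h t| ^ p := hc.abs.rpow_const fun _ ↦ Or.inr (by linarith)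
  have hpc' : Continuous fun t ↦ |h t| ^ (p - 2) := hc.abs.rpow_const fun _ ↦ Or.inr (by linarith)
  have hAc : Continuous fun t ↦ (α * δ - β ^ 2) / q t * |h t| ^ p :=
    (continuous_const.div hqc fun t ↦ (hqpos t).ne').mul hpc
  have hBc : Continuous fun t ↦ (p / 2) ^ 2 * |h t| ^ (p - 2) * (h' t ^ 2 * q t) := by fun_prop
  have hF : ∀ t, HasDerivAt (fun t ↦ |h t| ^ p) (p * |h t| ^ (p - 2) * h t * h' t) t := fun t ↦
    (hasDerivAt_abs_rpow (h t) (by linarith)).comp t (hh t)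
  -- With D = αδ - β² > 0 and θ the polar angle along the ellipse, dθ = √D/q dt, and the factor
  -- multiplying |h|^p is √D cot θ: this is the classical Wirtinger argument with cotangent, written
  -- in the parameter t.
  set g : ℝ → ℝ := fun t ↦ |h t| ^ p / Real.sin t * (α * Real.cos t + β * Real.sin t) with hg
  have hgc : ContinuousOn g (Icc 0 Real.pi) := by
    intro t ht
    refine ContinuousAt.continuousWithinAt (ContinuousAt.mul ?_ (by fun_prop))
    by_cases hs : Real.sin t = 0
    · have ht0 : h t = 0 := by
        rcases ht.1.eq_or_lt with rfl | h1
        · exact h0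
        rcases ht.2.eq_or_lt with rfl | h2
        · exact hπ
        exact absurd hs (Real.sin_pos_of_pos_of_lt_pi h1 h2).ne'
      refine continuousAt_div_of_hasDerivAt_zero (by simpa [ht0] using hF t)
        (Real.hasDerivAt_sin t) (by simp [ht0, Real.zero_rpow (show p ≠ 0 by linarith)]) hs ?_
      intro h
      have := Real.sin_sq_add_cos_sq t
      simp [hs, h] at this
    · exact hpc.continuousAt.div (Real.continuous_sin.continuousAt) hs
  have hgd : ∀ t ∈ Ioo 0 Real.pi, HasDerivWithinAt g
      ((p * |h t| ^ (p - 2) * h t * h' t * Real.sin t - |h t| ^ p * Real.cos t) / Real.sin t ^ 2 *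
        (α * Real.cos t + β * Real.sin t) +
        |h t| ^ p / Real.sin t * (α * -Real.sin t + β * Real.cos t)) (Ioi t) t := by
    intro t ht
    have hs := (Real.sin_pos_of_pos_of_lt_pi ht.1 ht.2).ne'
    exact (((hF t).div (Real.hasDerivAt_sin t) hs).mul
      (((Real.hasDerivAt_cos t).const_mul α).add
        ((Real.hasDerivAt_sin t).const_mul β))).hasDerivWithinAt
  have hle := intervalIntegral.sub_le_integral_of_hasDeriv_right_of_le Real.pi_pos.le hgc hgd
    (φ := fun t ↦ (p / 2) ^ 2 * |h t| ^ (p - 2) * (h' t ^ 2 * q t) -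
      (α * δ - β ^ 2) / q t * |h t| ^ p)
    ((hBc.sub hAc).integrableOn_Icc) ?_
  · rw [intervalIntegral.integral_sub (hBc.intervalIntegrable _ _) (hAc.intervalIntegrable _ _)]
      at hle
    simp only [hg, Real.sin_zero, Real.sin_pi, div_zero, zero_mul, sub_zero] at hle
    linarith
  · intro t ht
    have hs := Real.sin_pos_of_pos_of_lt_pi ht.1 ht.2
    have hqt := hqpos t
    have hsc := Real.sin_sq_add_cos_sq t
    set S := Real.sin t
    set C := Real.cos t
    set K := (α * C + β * S) / S with hK
    -- Riccati equation for K, since K' = -α/S². It makes the difference of the two sides equal to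
    -- |h|^(p-2) times the square in `h2`.
    have hid : K ^ 2 + (α * δ - β ^ 2) = α * q t / S ^ 2 := by
      rw [hK, hq t]
      change _ = α * (α * C ^ 2 + 2 * β * (S * C) + δ * S ^ 2) / S ^ 2
      field_simp
      ring
    have hl : (p * |h t| ^ (p - 2) * h t * h' t * S - |h t| ^ p * C) / S ^ 2 *
        (α * C + β * S) + |h t| ^ p / S * (α * -S + β * C) =
        |h t| ^ (p - 2) * (p * (h t * h' t) * K - h t ^ 2 * (α / S ^ 2)) := by
      rw [abs_rpow_eq_mul_sq hp, hK]
      field_simp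
      linear_combination (-(|h t| ^ (p - 2) * h t ^ 2 * α)) * hsc
    have hr : (p / 2) ^ 2 * |h t| ^ (p - 2) * (h' t ^ 2 * q t) -
        (α * δ - β ^ 2) / q t * |h t| ^ p =
        |h t| ^ (p - 2) * ((p / 2) ^ 2 * (h' t ^ 2 * q t) - (α * δ - β ^ 2) / q t * h t ^ 2) := by
      rw [abs_rpow_eq_mul_sq hp]; ring
    rw [hl, hr]
    refine mul_le_mul_of_nonneg_left ?_ (by positivity)
    have h1 : α / S ^ 2 = (K ^ 2 + (α * δ - β ^ 2)) / q t := by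
      rw [hid]; field_simp
    rw [h1]
    have h2 : 0 ≤ (p / 2 * (h' t * q t) - h t * K) ^ 2 / q t := by positivity
    have h3 : (p / 2 * (h' t * q t) - h t * K) ^ 2 / q t =
      (p / 2) ^ 2 * (h' t ^ 2 * q t) - (α * δ - β ^ 2) / q t * h t ^ 2 -
      (p * (h t * h' t) * K - h t ^ 2 * ((K ^ 2 + (α * δ - β ^ 2)) / q t)) := by
      field_simp
      ring
    linarith

end Circle

/-! ### Great circles traced by rotating a pair of vectors -/

section Sphere

open Set Filter Topology Module ProbabilityTheory
open scoped ENNReal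

variable {E : Type*} [NormedAddCommGroup E] [InnerProductSpace ℝ E]

/-- The squared derivative, along the rotation of the pair `(x, y)`, of the `0`-homogeneous
function that agrees with `u` on the sphere of radius `s`, multiplied by `‖x‖ ^ 2` and by
`(p / 2) ^ 2 * |u| ^ (p - 2)`. -/
noncomputable def circleEnergy (p s : ℝ) (u : E → ℝ) (w : E → E) (z : E × E) : ℝ :=
  (p / 2) ^ 2 * |u (s • ‖z.1‖⁻¹ • z.1)| ^ (p - 2) *
    (s * inner ℝ (w (s • ‖z.1‖⁻¹ • z.1) -
      inner ℝ (w (s • ‖z.1‖⁻¹ • z.1)) (‖z.1‖⁻¹ • z.1) • ‖z.1‖⁻¹ • z.1) z.2) ^ 2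

/-- The counterpart of `circleEnergy` without derivatives. -/
noncomputable def circleMass (p s : ℝ) (u : E → ℝ) (z : E × E) : ℝ :=
  (‖z.1‖ ^ 2 * ‖z.2‖ ^ 2 - inner ℝ z.1 z.2 ^ 2) / ‖z.1‖ ^ 2 * |u (s • ‖z.1‖⁻¹ • z.1)| ^ p

theorem norm_sq_cos_smul_add_sin_smul (x y : E) (t : ℝ) :
    ‖Real.cos t • x + Real.sin t • y‖ ^ 2 = ‖x‖ ^ 2 * Real.cos t ^ 2 +
      2 * inner ℝ x y * (Real.sin t * Real.cos t) + ‖y‖ ^ 2 * Real.sin t ^ 2 := by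
  rw [norm_add_sq_real, norm_smul, norm_smul, real_inner_smul_left, real_inner_smul_right,
    mul_pow, mul_pow, Real.norm_eq_abs, Real.norm_eq_abs, sq_abs, sq_abs]
  ring

theorem inner_rotation (x y : E) (t : ℝ) :
    inner ℝ (Real.cos t • x + Real.sin t • y) (-Real.sin t • x + Real.cos t • y) =
      (‖y‖ ^ 2 - ‖x‖ ^ 2) * (Real.sin t * Real.cos t) +
        inner ℝ x y * (Real.cos t ^ 2 - Real.sin t ^ 2) := by
  simp only [inner_add_left, inner_add_right, real_inner_smul_left, real_inner_smul_right,
    real_inner_self_eq_norm_sq, real_inner_comm x y]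
  ring

/-- The Gram determinant of a pair is invariant under rotation. -/
theorem gram_rotation (z : E × E) (t : ℝ) :
    ‖(ContinuousLinearMap.rotation t z).1‖ ^ 2 * ‖(ContinuousLinearMap.rotation t z).2‖ ^ 2 -
      inner ℝ (ContinuousLinearMap.rotation t z).1 (ContinuousLinearMap.rotation t z).2 ^ 2 =
    ‖z.1‖ ^ 2 * ‖z.2‖ ^ 2 - inner ℝ z.1 z.2 ^ 2 := by
  simp only [ContinuousLinearMap.rotation_apply]
  have h2 : ‖-Real.sin t • z.1 + Real.cos t • z.2‖ ^ 2 = ‖z.1‖ ^ 2 * Real.sin t ^ 2 -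
      2 * inner ℝ z.1 z.2 * (Real.sin t * Real.cos t) + ‖z.2‖ ^ 2 * Real.cos t ^ 2 := by
    rw [norm_add_sq_real, norm_smul, norm_smul, real_inner_smul_left, real_inner_smul_right,
      mul_pow, mul_pow, Real.norm_eq_abs, Real.norm_eq_abs, sq_abs, sq_abs]
    ring
  rw [h2, norm_sq_cos_smul_add_sin_smul, inner_rotation]
  have h := Real.sin_sq_add_cos_sq t
  set S := Real.sin t
  set C := Real.cos t
  have hS : S ^ 2 = 1 - C ^ 2 := by linarith
  have hS4 : S ^ 4 = (1 - C ^ 2) ^ 2 := by rw [← hS]; ring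
  ring_nf
  rw [hS4, hS]
  ring

theorem rotation_rotation (θ t : ℝ) (z : E × E) :
    ContinuousLinearMap.rotation t (ContinuousLinearMap.rotation θ z) =
      ContinuousLinearMap.rotation (t + θ) z := by
  simp only [ContinuousLinearMap.rotation_apply, Real.cos_add, Real.sin_add, Prod.mk.injEq]
  constructor <;> module

theorem rotation_add_pi (t : ℝ) (z : E × E) :
    ContinuousLinearMap.rotation (t + Real.pi) z = -ContinuousLinearMap.rotation t z := by
  simp only [ContinuousLinearMap.rotation_apply, Real.cos_add_pi, Real.sin_add_pi, Prod.neg_mk,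
    Prod.mk.injEq]
  constructor <;> module

/-- Normalizing a curve c projects its velocity orthogonally to c and divides it by ‖c‖. The
projection is moved onto the gradient, so that the formula is linear in the second vector, as the
Gaussian average over that vector requires. -/
theorem hasDerivAt_sphere_rotation [CompleteSpace E] {u : E → ℝ} {w : E → E}
    (hw : ∀ x, HasGradientAt u (w x) x)
    (s : ℝ) (z : E × E) (t : ℝ) (hz : (ContinuousLinearMap.rotation t z).1 ≠ 0) :
    HasDerivAt (fun t ↦ u (s • ‖(ContinuousLinearMap.rotation t z).1‖⁻¹ •
        (ContinuousLinearMap.rotation t z).1))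
      (s * inner ℝ (w (s • ‖(ContinuousLinearMap.rotation t z).1‖⁻¹ •
        (ContinuousLinearMap.rotation t z).1) -
        inner ℝ (w (s • ‖(ContinuousLinearMap.rotation t z).1‖⁻¹ •
          (ContinuousLinearMap.rotation t z).1))
        (‖(ContinuousLinearMap.rotation t z).1‖⁻¹ • (ContinuousLinearMap.rotation t z).1) •
        ‖(ContinuousLinearMap.rotation t z).1‖⁻¹ • (ContinuousLinearMap.rotation t z).1)
        (ContinuousLinearMap.rotation t z).2 / ‖(ContinuousLinearMap.rotation t z).1‖) t := by
  simp only [ContinuousLinearMap.rotation_apply] at *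
  set c : ℝ → E := fun t ↦ Real.cos t • z.1 + Real.sin t • z.2 with hc
  set c' : E := -Real.sin t • z.1 + Real.cos t • z.2 with hc'
  have hcd : HasDerivAt c c' t :=
    ((Real.hasDerivAt_cos t).smul_const z.1).add ((Real.hasDerivAt_sin t).smul_const z.2)
  have hn : HasDerivAt (fun t ↦ ‖c t‖) (inner ℝ (c t) c' / ‖c t‖) t := by
    have h1 := (hcd.norm_sq).sqrt (by simpa using hz)
    simp only [Real.sqrt_sq (norm_nonneg _)] at h1
    convert h1 using 1
    field_simp
  have hn0 : ‖c t‖ ≠ 0 := norm_ne_zero_iff.2 hz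
  have hv := ((hn.inv hn0).smul hcd).const_smul s
  have hu := (hw (s • ‖c t‖⁻¹ • c t)).hasFDerivAt.comp_hasDerivAt t hv
  refine hu.congr_deriv ?_
  change _ = s * inner ℝ (w (s • ‖c t‖⁻¹ • c t) - inner ℝ (w (s • ‖c t‖⁻¹ • c t)) (‖c t‖⁻¹ • c t) •
    ‖c t‖⁻¹ • c t) c' / ‖c t‖
  generalize w (s • ‖c t‖⁻¹ • c t) = W
  simp only [InnerProductSpace.toDual_apply_apply, inner_smul_right, inner_add_right,
    inner_sub_left, real_inner_smul_left, Pi.inv_apply]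
  field_simp
  ring

/-- Rotation by π negates the pair, so by oddness a zero at t = 0 is also a zero at t = π. Then
`wirtinger_ellipse` applies, its coefficients α, β, δ being the Gram entries of the pair. -/
theorem circle_inequality_aux [CompleteSpace E] {p s : ℝ} (hp : 2 ≤ p) {u : E → ℝ} {w : E → E}
    (hw : ∀ x, HasGradientAt u (w x) x) (hwc : Continuous w) (hodd : ∀ x, u (-x) = -u x) (z : E × E)
    (hD : 0 < ‖z.1‖ ^ 2 * ‖z.2‖ ^ 2 - inner ℝ z.1 z.2 ^ 2) (hz : u (s • ‖z.1‖⁻¹ • z.1) = 0) :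
    ∫ t in 0..Real.pi, circleMass p s u (ContinuousLinearMap.rotation t z) ≤
      ∫ t in 0..Real.pi, circleEnergy p s u w (ContinuousLinearMap.rotation t z) := by
  have hne : ∀ t, (ContinuousLinearMap.rotation t z).1 ≠ 0 := fun t h0 ↦ by
    have := gram_rotation z t
    rw [h0] at this
    simp at this
    simp at hD
    linarith
  have hcont : Continuous fun t ↦ ContinuousLinearMap.rotation t z := by
    simp only [ContinuousLinearMap.rotation_apply]; fun_prop
  have hpos : ∀ t, 0 < ‖(ContinuousLinearMap.rotation t z).1‖ := fun t ↦ norm_pos_iff.2 (hne t)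
  have hnc : Continuous fun t ↦ ‖(ContinuousLinearMap.rotation t z).1‖⁻¹ :=
    Continuous.inv₀ (by fun_prop) fun t ↦ (hpos t).ne'
  have h := wirtinger_ellipse hp (fun t ↦ hasDerivAt_sphere_rotation hw s z t (hne t))
    (Continuous.div (by fun_prop) (by fun_prop) fun t ↦ (hpos t).ne')
    (by simpa [ContinuousLinearMap.rotation_apply] using hz)
    (by simpa [ContinuousLinearMap.rotation_apply, hodd] using hz)
    (q := fun t ↦ ‖(ContinuousLinearMap.rotation t z).1‖ ^ 2) (fun t ↦ pow_pos (hpos t) 2)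
    (fun t ↦ norm_sq_cos_smul_add_sin_smul z.1 z.2 t)
  refine le_trans (le_of_eq ?_) (h.trans (le_of_eq ?_))
  · refine intervalIntegral.integral_congr fun t _ ↦ ?_
    simp only [circleMass]
    rw [gram_rotation]
  · refine intervalIntegral.integral_congr fun t _ ↦ ?_
    simp only [circleEnergy]
    have := (hpos t).ne'
    field_simp

end Sphere

/-! ### Poincaré inequality for odd functions on spheres -/

section SphereAverage

open Set Filter Topology Module ProbabilityTheory
open scoped ENNReal

variable {E : Type*} [NormedAddCommGroup E] [InnerProductSpace ℝ E]

theorem circleEnergy_neg {p s : ℝ} {u : E → ℝ} {w : E → E} (hodd : ∀ x, u (-x) = -u x)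
    (hw : ∀ x, w (-x) = w x) (z : E × E) : circleEnergy p s u w (-z) = circleEnergy p s u w z := by
  simp [circleEnergy, hodd, hw]

theorem circleMass_neg {p s : ℝ} {u : E → ℝ} (hodd : ∀ x, u (-x) = -u x) (z : E × E) :
    circleMass p s u (-z) = circleMass p s u z := by
  simp [circleMass, hodd]

theorem circleEnergy_nonneg (p s : ℝ) (u : E → ℝ) (w : E → E) (z : E × E) :
    0 ≤ circleEnergy p s u w z := by
  unfold circleEnergy; positivity

theorem circleMass_nonneg (p s : ℝ) (u : E → ℝ) (z : E × E) : 0 ≤ circleMass p s u z := by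
  have : 0 ≤ ‖z.1‖ ^ 2 * ‖z.2‖ ^ 2 - inner ℝ z.1 z.2 ^ 2 := by
    rw [← mul_pow, sub_nonneg, ← sq_abs (inner ℝ z.1 z.2)]
    exact pow_le_pow_left₀ (abs_nonneg _) (abs_real_inner_le_norm _ _) 2
  unfold circleMass; positivity

theorem gradient_even [CompleteSpace E] {u : E → ℝ} {w : E → E}
    (hw : ∀ x, HasGradientAt u (w x) x) (hodd : ∀ x, u (-x) = -u x) (x : E) : w (-x) = w x := by
  have h1 : HasFDerivAt (fun y ↦ -u (-y)) (InnerProductSpace.toDual ℝ E (w (-x))) x := by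
    have := ((hw (-x)).hasFDerivAt.comp x (hasFDerivAt_id x).neg).neg
    refine this.congr_fderiv ?_
    ext v
    simp
  have h2 : (fun y ↦ -u (-y)) = u := funext fun y ↦ by simp [hodd]
  rw [h2] at h1
  exact (InnerProductSpace.toDual ℝ E).injective (h1.unique (hw x).hasFDerivAt)

theorem circle_inequality [CompleteSpace E] {p s : ℝ} (hp : 2 ≤ p) {u : E → ℝ} {w : E → E}
    (hw : ∀ x, HasGradientAt u (w x) x) (hwc : Continuous w) (hodd : ∀ x, u (-x) = -u x)
    (z : E × E) :
    ∫⁻ t in Ioc 0 Real.pi,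
        ENNReal.ofReal (circleMass p s u (ContinuousLinearMap.rotation t z)) ≤
      ∫⁻ t in Ioc 0 Real.pi,
        ENNReal.ofReal (circleEnergy p s u w (ContinuousLinearMap.rotation t z)) := by
  have hD0 : 0 ≤ ‖z.1‖ ^ 2 * ‖z.2‖ ^ 2 - inner ℝ z.1 z.2 ^ 2 := by
    rw [← mul_pow, sub_nonneg, ← sq_abs (inner ℝ z.1 z.2)]
    exact pow_le_pow_left₀ (abs_nonneg _) (abs_real_inner_le_norm _ _) 2
  rcases hD0.eq_or_lt with hD | hD
  -- For linearly dependent vectors the mass vanishes identically; otherwise the ellipse avoids the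
  -- origin.
  · simp [circleMass, gram_rotation, ← hD]
  have hne : ∀ t, (ContinuousLinearMap.rotation t z).1 ≠ 0 := fun t h0 ↦ by
    have := gram_rotation z t
    rw [h0] at this
    simp at this
    simp at hD
    linarith
  have hu : Continuous u :=
    continuous_iff_continuousAt.2 fun x ↦ (hw x).hasFDerivAt.continuousAt
  have hcont : Continuous fun t ↦ ContinuousLinearMap.rotation t z := by
    simp only [ContinuousLinearMap.rotation_apply]; fun_prop
  have hpos : ∀ t, 0 < ‖(ContinuousLinearMap.rotation t z).1‖ := fun t ↦ norm_pos_iff.2 (hne t)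
  have hnc : Continuous fun t ↦ ‖(ContinuousLinearMap.rotation t z).1‖⁻¹ :=
    Continuous.inv₀ (by fun_prop) fun t ↦ (hpos t).ne'
  have hhc : Continuous fun t ↦ u (s • ‖(ContinuousLinearMap.rotation t z).1‖⁻¹ •
      (ContinuousLinearMap.rotation t z).1) := by fun_prop
  have hpc := hhc.abs.rpow_const (p := p) fun _ ↦ Or.inr (by linarith)
  have hpc' := hhc.abs.rpow_const (p := p - 2) fun _ ↦ Or.inr (by linarith)
  have hMc : Continuous fun t ↦ circleMass p s u (ContinuousLinearMap.rotation t z) := by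
    simp only [circleMass]
    refine Continuous.mul (Continuous.div (by fun_prop) (by fun_prop) fun t ↦ ?_) hpc
    exact (pow_pos (hpos t) 2).ne'
  have hEc : Continuous fun t ↦ circleEnergy p s u w (ContinuousLinearMap.rotation t z) := by
    simp only [circleEnergy]
    fun_prop
  -- Values at parameters differing by π are opposite, so the intermediate value theorem gives a
  -- zero. The inequality is started there and moved back to [0, π] by π-periodicity of both
  -- integrands.
  obtain ⟨θ, hθ⟩ : ∃ θ, u (s • ‖(ContinuousLinearMap.rotation θ z).1‖⁻¹ •
      (ContinuousLinearMap.rotation θ z).1) = 0 := by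
    have h0 := mem_range_self (f := fun t ↦ u (s • ‖(ContinuousLinearMap.rotation t z).1‖⁻¹ •
      (ContinuousLinearMap.rotation t z).1)) 0
    have hπ := mem_range_self (f := fun t ↦ u (s • ‖(ContinuousLinearMap.rotation t z).1‖⁻¹ •
      (ContinuousLinearMap.rotation t z).1)) (0 + Real.pi)
    simp only [rotation_add_pi, Prod.fst_neg, norm_neg, smul_neg, hodd] at hπ
    set v := u (s • ‖(ContinuousLinearMap.rotation 0 z).1‖⁻¹ •
      (ContinuousLinearMap.rotation 0 z).1)
    have hI := (isPreconnected_range hhc).ordConnected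
    rcases le_total 0 v with hv | hv
    · exact hI.out hπ h0 ⟨by linarith, hv⟩
    · exact hI.out h0 hπ ⟨hv, by linarith⟩
  have key := circle_inequality_aux (s := s) hp hw hwc hodd (ContinuousLinearMap.rotation θ z)
    (by rwa [gram_rotation]) hθ
  simp only [rotation_rotation] at key
  have hMp : Function.Periodic
      (fun t ↦ circleMass p s u (ContinuousLinearMap.rotation t z)) Real.pi := fun t ↦ by
    simp only [rotation_add_pi, circleMass_neg hodd]
  have hEp : Function.Periodic
      (fun t ↦ circleEnergy p s u w (ContinuousLinearMap.rotation t z)) Real.pi := fun t ↦ by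
    simp only [rotation_add_pi, circleEnergy_neg hodd (gradient_even hw hodd)]
  rw [intervalIntegral.integral_comp_add_right
      (fun t ↦ circleMass p s u (ContinuousLinearMap.rotation t z)),
    intervalIntegral.integral_comp_add_right
      (fun t ↦ circleEnergy p s u w (ContinuousLinearMap.rotation t z)), zero_add,
    add_comm Real.pi, hMp.intervalIntegral_add_eq θ 0, hEp.intervalIntegral_add_eq θ 0, zero_add,
    intervalIntegral.integral_of_le Real.pi_pos.le,
    intervalIntegral.integral_of_le Real.pi_pos.le] at key
  rw [← ofReal_integral_eq_lintegral_ofReal hMc.integrableOn_Ioc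
      (ae_of_all _ fun t ↦ circleMass_nonneg _ _ _ _),
    ← ofReal_integral_eq_lintegral_ofReal hEc.integrableOn_Ioc
      (ae_of_all _ fun t ↦ circleEnergy_nonneg _ _ _ _ _)]
  exact ENNReal.ofReal_le_ofReal key

variable [FiniteDimensional ℝ E] [MeasurableSpace E] [BorelSpace E]

/-- Integrating along rotation orbits recovers the integral against the Gaussian measure
on pairs. -/
theorem lintegral_lintegral_rotation_stdGaussian {F : E × E → ℝ≥0∞} (hF : Measurable F) :
    ∫⁻ z, (∫⁻ t in Ioc 0 Real.pi, F (ContinuousLinearMap.rotation t z))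
        ∂((stdGaussian E).prod (stdGaussian E)) =
      ENNReal.ofReal Real.pi * ∫⁻ z, F z ∂((stdGaussian E).prod (stdGaussian E)) := by
  have hm : Measurable fun q : (E × E) × ℝ ↦ F (ContinuousLinearMap.rotation q.2 q.1) := by
    simp only [ContinuousLinearMap.rotation_apply]; fun_prop
  rw [lintegral_lintegral_swap hm.aemeasurable]
  -- The law of two independent standard Gaussian vectors is invariant under rotation of the pair.
  have : ∀ t, ∫⁻ z, F (ContinuousLinearMap.rotation t z)
      ∂((stdGaussian E).prod (stdGaussian E)) =
      ∫⁻ z, F z ∂((stdGaussian E).prod (stdGaussian E)) := fun t ↦ by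
    rw [← lintegral_map hF (by fun_prop),
      IsGaussian.map_rotation_eq_self_of_forall_strongDual_eq_zero
        (fun L ↦ integral_strongDual_stdGaussian L) t]
  simp_rw [this]
  simp [mul_comm]

/-- The vector y enters only through its inner product with the tangential gradient, whose Gaussian
second moment is the squared norm of that gradient. -/
theorem lintegral_circleEnergy_right {p s : ℝ} (u : E → ℝ) (w : E → E) {x : E} (hx : x ≠ 0) :
    ∫⁻ y, ENNReal.ofReal (circleEnergy p s u w (x, y)) ∂(stdGaussian E) =
      ENNReal.ofReal ((p / 2) ^ 2 * |u (s • ‖x‖⁻¹ • x)| ^ (p - 2) * (s ^ 2 *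
        (‖w (s • ‖x‖⁻¹ • x)‖ ^ 2 - inner ℝ (w (s • ‖x‖⁻¹ • x)) (‖x‖⁻¹ • x) ^ 2))) := by
  have hn : ‖‖x‖⁻¹ • x‖ = 1 := norm_smul_inv_norm (𝕜 := ℝ) hx
  simp only [circleEnergy]
  set e := ‖x‖⁻¹ • x
  set W := w (s • e)
  have h0 : 0 ≤ (p / 2) ^ 2 * |u (s • e)| ^ (p - 2) := by positivity
  have hb : ‖W - inner ℝ W e • e‖ ^ 2 = ‖W‖ ^ 2 - inner ℝ W e ^ 2 := by
    rw [norm_sub_sq_real, norm_smul, hn, mul_one, Real.norm_eq_abs, sq_abs, real_inner_smul_right]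
    ring
  simp_rw [mul_pow, ENNReal.ofReal_mul h0, ENNReal.ofReal_mul (sq_nonneg s)]
  rw [lintegral_const_mul _ (by fun_prop), lintegral_const_mul _ (by fun_prop),
    lintegral_inner_sq_stdGaussian, hb]

theorem lintegral_circleMass_right {p s : ℝ} (u : E → ℝ) {x : E} (hx : x ≠ 0) :
    ∫⁻ y, ENNReal.ofReal (circleMass p s u (x, y)) ∂(stdGaussian E) =
      ENNReal.ofReal ((finrank ℝ E - 1) * |u (s • ‖x‖⁻¹ • x)| ^ p) := by
  have hn : ‖‖x‖⁻¹ • x‖ = 1 := norm_smul_inv_norm (𝕜 := ℝ) hx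
  have hx' : ‖x‖ ≠ 0 := norm_ne_zero_iff.2 hx
  have h1 : ∀ y, circleMass p s u (x, y) =
      (‖y‖ ^ 2 - inner ℝ (‖x‖⁻¹ • x) y ^ 2) * |u (s • ‖x‖⁻¹ • x)| ^ p := fun y ↦ by
    simp only [circleMass, real_inner_smul_left]
    field_simp
  simp_rw [h1]
  set e := ‖x‖⁻¹ • x
  have h2 : ∀ y : E, 0 ≤ ‖y‖ ^ 2 - inner ℝ e y ^ 2 := fun y ↦ by
    have := abs_real_inner_le_norm e y
    rw [hn, one_mul] at this
    rw [sub_nonneg, ← sq_abs (inner ℝ e y)]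
    exact pow_le_pow_left₀ (abs_nonneg _) this 2
  -- The full second moment is the dimension and the direction `e` accounts for 1 of it; stated as a
  -- sum to avoid truncated subtraction.
  have hsum : ∫⁻ y, ENNReal.ofReal (‖y‖ ^ 2 - inner ℝ e y ^ 2) ∂(stdGaussian E) + 1 =
      finrank ℝ E := by
    rw [← lintegral_norm_sq_stdGaussian, ← ENNReal.ofReal_one, ← one_pow (M := ℝ) 2, ← hn,
      ← lintegral_inner_sq_stdGaussian, ← lintegral_add_left (by fun_prop)]
    refine lintegral_congr fun y ↦ ?_
    rw [← ENNReal.ofReal_add (h2 y) (sq_nonneg _), sub_add_cancel]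
  have hval : ∫⁻ y, ENNReal.ofReal (‖y‖ ^ 2 - inner ℝ e y ^ 2) ∂(stdGaussian E) =
      ENNReal.ofReal (finrank ℝ E - 1) := by
    rw [ENNReal.ofReal_sub _ zero_le_one, ENNReal.ofReal_natCast, ← hsum, ENNReal.ofReal_one,
      ENNReal.add_sub_cancel_right ENNReal.one_ne_top]
  have h3 : 0 ≤ |u (s • e)| ^ p := by positivity
  simp_rw [ENNReal.ofReal_mul' h3]
  rw [lintegral_mul_const _ (by fun_prop), hval]

theorem ae_ne_zero_stdGaussian [Nontrivial E] : ∀ᵐ x ∂(stdGaussian E), x ≠ 0 := by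
  obtain ⟨c, -, hγ⟩ := stdGaussian_eq_withDensity (E := E)
  have h : ∀ᵐ x ∂(volume : Measure E), x ≠ 0 := by simp [ae_iff]
  rw [hγ]
  exact (withDensity_absolutelyContinuous _ _).ae_le h

/-- The sharp Poincaré inequality for odd functions on a sphere of radius `s`, with a power
weight; the sphere is parametrized by the directions of Gaussian vectors. -/
theorem sphere_poincare_odd [Nontrivial E] {p s : ℝ} (hp : 2 ≤ p) {u : E → ℝ} {w : E → E}
    (hw : ∀ x, HasGradientAt u (w x) x) (hwc : Continuous w) (hodd : ∀ x, u (-x) = -u x) :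
    ∫⁻ x, ENNReal.ofReal ((finrank ℝ E - 1) * |u (s • ‖x‖⁻¹ • x)| ^ p) ∂(stdGaussian E) ≤
      ∫⁻ x, ENNReal.ofReal ((p / 2) ^ 2 * |u (s • ‖x‖⁻¹ • x)| ^ (p - 2) * (s ^ 2 *
        (‖w (s • ‖x‖⁻¹ • x)‖ ^ 2 - inner ℝ (w (s • ‖x‖⁻¹ • x)) (‖x‖⁻¹ • x) ^ 2)))
          ∂(stdGaussian E) := by
  have hu : Measurable u :=
    (continuous_iff_continuousAt.2 fun x ↦ (hw x).hasFDerivAt.continuousAt).measurable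
  have hwm := hwc.measurable
  have hM : Measurable fun z : E × E ↦ ENNReal.ofReal (circleMass p s u z) := by
    simp only [circleMass]; fun_prop
  have hEn : Measurable fun z : E × E ↦ ENNReal.ofReal (circleEnergy p s u w z) := by
    simp only [circleEnergy]; fun_prop
  have h := lintegral_mono (μ := (stdGaussian E).prod (stdGaussian E))
    fun z ↦ circle_inequality (s := s) hp hw hwc hodd z
  rw [lintegral_lintegral_rotation_stdGaussian hM, lintegral_lintegral_rotation_stdGaussian hEn,
    ENNReal.mul_le_mul_iff_right (by simp [Real.pi_pos]) (by simp),
    lintegral_prod _ hM.aemeasurable, lintegral_prod _ hEn.aemeasurable] at h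
  rwa [lintegral_congr_ae (ae_ne_zero_stdGaussian.mono fun x hx ↦
      lintegral_circleMass_right u hx),
    lintegral_congr_ae (ae_ne_zero_stdGaussian.mono fun x hx ↦
      lintegral_circleEnergy_right u w hx)] at h

end SphereAverage

/-! ### The inequality for compactly supported C¹ functions -/

section SmoothHardy

open Set Filter Topology Module ProbabilityTheory
open scoped ENNReal

variable {E : Type*} [NormedAddCommGroup E] [InnerProductSpace ℝ E]

theorem norm_smul_normalize {x : E} (hx : x ≠ 0) {r : ℝ} (hr : 0 < r) : ‖r • ‖x‖⁻¹ • x‖ = r := by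
  have h : ‖‖x‖⁻¹ • x‖ = 1 := norm_smul_inv_norm (𝕜 := ℝ) hx
  rw [norm_smul, h, mul_one, Real.norm_of_nonneg hr.le]

variable [FiniteDimensional ℝ E] [MeasurableSpace E] [BorelSpace E]

theorem radial_hardy_space [Nontrivial E] {p : ℝ} (hp : 2 ≤ p) {u : E → ℝ} {w : E → E}
    (hu : ContDiff ℝ 1 u) (hus : HasCompactSupport u) (hw : ∀ x, HasGradientAt u (w x) x)
    (hwc : Continuous w) (hu0 : u 0 = 0) :
    ∫⁻ x, ENNReal.ofReal (((finrank ℝ E - p) / 2) ^ 2 * (|u x| ^ p / ‖x‖ ^ p)) ≤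
      ∫⁻ x, ENNReal.ofReal ((p / 2) ^ 2 * (|u x| / ‖x‖) ^ (p - 2) *
        inner ℝ (w x) (‖x‖⁻¹ • x) ^ 2) := by
  have hum := hu.continuous.measurable
  have hwm := hwc.measurable
  obtain ⟨κ, hκ0, hκ, H⟩ := exists_lintegral_stdGaussian_ray (E := E)
  rw [← ENNReal.mul_le_mul_iff_right hκ0 hκ, ← H _ (by fun_prop), ← H _ (by fun_prop)]
  refine lintegral_mono_ae (ae_ne_zero_stdGaussian.mono fun x hx ↦ ?_)
  have hn := fun r (hr : 0 < r) ↦ norm_smul_normalize hx hr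
  set e := ‖x‖⁻¹ • x with he
  have he0 : e ≠ 0 := smul_ne_zero (inv_ne_zero (norm_ne_zero_iff.2 hx)) hx
  have hfd : ∀ r, HasDerivAt (fun r : ℝ ↦ u (r • e)) (inner ℝ (w (r • e)) e) r := fun r ↦ by
    have h := (hw (r • e)).hasFDerivAt.comp_hasDerivAt r ((hasDerivAt_id r).smul_const e)
    refine h.congr_deriv ?_
    simp
  have h := radial_hardy_lintegral hp (Module.finrank_pos (R := ℝ) (M := E))
    (f := fun r ↦ u (r • e)) (hu.comp (by fun_prop)) (by simpa using hu0)
    (hus.comp_isClosedEmbedding (isClosedEmbedding_smul_left he0))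
  refine le_trans (le_of_eq ?_) (h.trans (le_of_eq ?_))
  · refine setLIntegral_congr_fun measurableSet_Ioi fun r hr ↦ ?_
    simp only [hn r hr]
  · refine setLIntegral_congr_fun measurableSet_Ioi fun r hr ↦ ?_
    have hr' : r ≠ 0 := ne_of_gt hr
    simp only [hn r hr, (hfd r).deriv, smul_smul, inv_mul_cancel₀ hr', one_smul]

/-- Tonelli puts the radius outside, so that `sphere_poincare_odd` applies on each sphere.
Multiplied by r^(-p), its factor r² leaves r^(-(p-2)), the weight on the right. -/
theorem tangential_hardy_space [Nontrivial E] {p : ℝ} (hp : 2 ≤ p) {u : E → ℝ} {w : E → E}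
    (hu : Continuous u) (hw : ∀ x, HasGradientAt u (w x) x)
    (hwc : Continuous w) (hodd : ∀ x, u (-x) = -u x) :
    ∫⁻ x, ENNReal.ofReal ((finrank ℝ E - 1) * (|u x| ^ p / ‖x‖ ^ p)) ≤
      ∫⁻ x, ENNReal.ofReal ((p / 2) ^ 2 * (|u x| / ‖x‖) ^ (p - 2) *
        (‖w x‖ ^ 2 - inner ℝ (w x) (‖x‖⁻¹ • x) ^ 2)) := by
  have hum := hu.measurable
  have hwm := hwc.measurable
  obtain ⟨κ, hκ0, hκ, H⟩ := exists_lintegral_stdGaussian_ray (E := E)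
  have swap : ∀ F : E → ℝ≥0∞, Measurable F → κ * ∫⁻ x, F x =
      ∫⁻ r in Ioi (0 : ℝ), ENNReal.ofReal (r ^ (finrank ℝ E - 1)) *
        ∫⁻ x, F (r • ‖x‖⁻¹ • x) ∂(stdGaussian E) := fun F hF ↦ by
    have hm : Measurable fun q : E × ℝ ↦
      ENNReal.ofReal (q.2 ^ (finrank ℝ E - 1)) * F (q.2 • ‖q.1‖⁻¹ • q.1) := by fun_prop
    rw [← H F hF, lintegral_lintegral_swap hm.aemeasurable]
    exact lintegral_congr fun r ↦ lintegral_const_mul _ (by fun_prop)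
  rw [← ENNReal.mul_le_mul_iff_right hκ0 hκ, swap _ (by fun_prop), swap _ (by fun_prop)]
  refine setLIntegral_mono' measurableSet_Ioi fun r hr ↦ ?_
  have hr : 0 < r := hr
  have hrp : 0 ≤ (r ^ p)⁻¹ := by positivity
  gcongr ENNReal.ofReal (r ^ (finrank ℝ E - 1)) * ?_
  have h := mul_le_mul_right (sphere_poincare_odd (s := r) hp hw hwc hodd)
    (ENNReal.ofReal (r ^ p)⁻¹)
  rw [← lintegral_const_mul _ (by fun_prop), ← lintegral_const_mul _ (by fun_prop)] at h
  refine le_trans (le_of_eq ?_) (h.trans (le_of_eq ?_))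
  · refine lintegral_congr_ae (ae_ne_zero_stdGaussian.mono fun x hx ↦ ?_)
    simp only [← ENNReal.ofReal_mul hrp, norm_smul_normalize hx hr]
    congr 1
    ring
  · refine lintegral_congr_ae (ae_ne_zero_stdGaussian.mono fun x hx ↦ ?_)
    have e3 : r ^ p = r ^ (p - 2) * r ^ 2 := by
      rw [← Real.rpow_natCast r 2, ← Real.rpow_add hr]; congr 1; push_cast; ring
    simp only [← ENNReal.ofReal_mul hrp, norm_smul_normalize hx hr, smul_smul r⁻¹ r,
      inv_mul_cancel₀ hr.ne', one_smul]
    rw [Real.div_rpow (abs_nonneg _) hr.le, e3]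
    congr 1
    have : 0 < r ^ (p - 2) := by positivity
    field_simp

theorem quadratic_hardy_odd [Nontrivial E] {p : ℝ} (hp : 2 ≤ p) {u : E → ℝ} {w : E → E}
    (hu : ContDiff ℝ 1 u) (hus : HasCompactSupport u) (hw : ∀ x, HasGradientAt u (w x) x)
    (hwc : Continuous w) (hodd : ∀ x, u (-x) = -u x) :
    ∫⁻ x, ENNReal.ofReal ((((finrank ℝ E - p) / 2) ^ 2 + (finrank ℝ E - 1)) *
        (|u x| ^ p / ‖x‖ ^ p)) ≤
      ∫⁻ x, ENNReal.ofReal ((p / 2) ^ 2 * (|u x| / ‖x‖) ^ (p - 2) * ‖w x‖ ^ 2) := by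
  have hum := hu.continuous.measurable
  have hwm := hwc.measurable
  have hd : (1 : ℝ) ≤ finrank ℝ E := by exact_mod_cast Module.finrank_pos (R := ℝ) (M := E)
  have hu0 : u 0 = 0 := by
    have := hodd 0
    rw [neg_zero] at this
    linarith
  have h := add_le_add (radial_hardy_space hp hu hus hw hwc hu0)
    (tangential_hardy_space hp hu.continuous hw hwc hodd)
  rw [← lintegral_add_left (by fun_prop), ← lintegral_add_left (by fun_prop)] at h
  refine le_trans (le_of_eq ?_) (h.trans (le_of_eq ?_))
  · refine lintegral_congr fun x ↦ ?_
    have : 0 ≤ |u x| ^ p / ‖x‖ ^ p := by positivity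
    rw [← ENNReal.ofReal_add (by positivity) (mul_nonneg (by linarith) this), add_mul]
  · refine lintegral_congr fun x ↦ ?_
    have h1 : inner ℝ (w x) (‖x‖⁻¹ • x) ^ 2 ≤ ‖w x‖ ^ 2 := by
      rw [← sq_abs (inner ℝ _ _)]
      refine pow_le_pow_left₀ (abs_nonneg _) ((abs_real_inner_le_norm _ _).trans ?_) 2
      refine mul_le_of_le_one_right (norm_nonneg _) ?_
      rw [norm_smul, norm_inv, norm_norm]
      exact inv_mul_le_one
    have h2 : 0 ≤ (p / 2) ^ 2 * (|u x| / ‖x‖) ^ (p - 2) := by positivity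
    rw [← ENNReal.ofReal_add (by positivity) (mul_nonneg h2 (by linarith)), ← mul_add,
      add_sub_cancel]

/-- Young's inequality in the form needed to pass from a quadratic to a `p`-th power estimate. -/
theorem sq_mul_rpow_sub_two_le {p m a b : ℝ} (hp : 2 ≤ p) (hm : 0 < m) (ha : 0 ≤ a) (hb : 0 ≤ b) :
    a ^ 2 * b ^ (p - 2) ≤ m * (2 / p * (a ^ p / m ^ (p / 2)) + (1 - 2 / p) * b ^ p) := by
  have hp0 : 0 < p := by linarith
  have h := Real.geom_mean_le_arith_mean2_weighted (w₁ := 2 / p) (w₂ := 1 - 2 / p)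
    (p₁ := a ^ p / m ^ (p / 2)) (p₂ := b ^ p) (by positivity)
    (by rw [sub_nonneg, div_le_one hp0]; exact hp) (by positivity) (by positivity) (by ring)
  have e1 : (a ^ p / m ^ (p / 2)) ^ (2 / p) = a ^ 2 / m := by
    rw [Real.div_rpow (by positivity) (by positivity), ← Real.rpow_mul ha, ← Real.rpow_mul hm.le,
      show p * (2 / p) = ((2 : ℕ) : ℝ) by push_cast; field_simp,
      show p / 2 * (2 / p) = 1 by field_simp, Real.rpow_one, Real.rpow_natCast]
  have e2 : (b ^ p) ^ (1 - 2 / p) = b ^ (p - 2) := by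
    rw [← Real.rpow_mul hb]; congr 1; field_simp
  rw [e1, e2] at h
  calc a ^ 2 * b ^ (p - 2) = m * (a ^ 2 / m * b ^ (p - 2)) := by field_simp
    _ ≤ _ := by gcongr

/-- Since u is Lipschitz and vanishes at 0, |u|/|x| is bounded, and its support is compact. -/
theorem integrable_rpow_div_norm_rpow {p : ℝ} (hp : 2 ≤ p) {u : E → ℝ}
    (hu : ContDiff ℝ 1 u) (hus : HasCompactSupport u) (hu0 : u 0 = 0) :
    Integrable fun x ↦ |u x| ^ p / ‖x‖ ^ p := by
  obtain ⟨L, hL⟩ := hu.lipschitzWith_of_hasCompactSupport hus (by norm_num)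
  have hum := hu.continuous.measurable
  have hb : ∀ x, |u x| ^ p / ‖x‖ ^ p ≤ (L : ℝ) ^ p := fun x ↦ by
    rw [← Real.div_rpow (abs_nonneg _) (norm_nonneg _)]
    refine Real.rpow_le_rpow (by positivity) ?_ (by linarith)
    refine div_le_of_le_mul₀ (norm_nonneg _) L.2 ?_
    simpa [hu0] using hL.dist_le_mul x 0
  have hi : IntegrableOn (fun x ↦ |u x| ^ p / ‖x‖ ^ p) (tsupport u) := by
    refine Measure.integrableOn_of_bounded (M := (L : ℝ) ^ p) hus.isCompact.measure_ne_top
      (Measurable.aestronglyMeasurable (by fun_prop)) (ae_of_all _ fun x ↦ ?_)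
    rw [Real.norm_of_nonneg (by positivity)]
    exact hb x
  refine (integrableOn_iff_integrable_of_support_subset fun x hx ↦ subset_tsupport u ?_).1 hi
  intro h0
  apply hx
  simp [h0, Real.zero_rpow (show p ≠ 0 by linarith)]

/-- Both bases agree because (d-p+2)²/4 + (p-2) = ((d-p)/2)² + (d-1). -/
theorem hardyConstOdd_eq {d : ℕ} {p : ℝ} (hp : 2 ≤ p) : hardyConstOdd d p =
    (((((d : ℝ) - p) / 2) ^ 2 + (d - 1)) * (4 / p ^ 2)) ^ (p / 2) := by
  unfold hardyConstOdd
  congr 1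
  field_simp
  ring

theorem hardyConstOdd_base_pos {d : ℕ} (hd : 1 ≤ d) {p : ℝ} (hp : 2 ≤ p) :
    0 < (((d : ℝ) - p) / 2) ^ 2 + (d - 1) := by
  rcases hd.eq_or_lt with rfl | h
  · have : ((1 : ℕ) : ℝ) - p ≠ 0 := by push_cast; linarith
    have : 0 < (((1 : ℕ) : ℝ) - p) ^ 2 := by positivity
    push_cast at *
    linarith [div_pow (1 - p) 2 2]
  · have : (1 : ℝ) < d := by exact_mod_cast h
    have : 0 < (d : ℝ) - 1 := by linarith
    positivity

theorem hardyConstOdd_pos {d : ℕ} (hd : 1 ≤ d) {p : ℝ} (hp : 2 ≤ p) : 0 < hardyConstOdd d p := by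
  have := hardyConstOdd_base_pos hd hp
  rw [hardyConstOdd_eq hp]
  positivity

/-- The sharp `p`-Hardy inequality for odd compactly supported `C¹` functions. -/
theorem hardy_odd_of_contDiff [Nontrivial E] {p : ℝ} (hp : 2 ≤ p) {u : E → ℝ} {w : E → E}
    (hu : ContDiff ℝ 1 u) (hus : HasCompactSupport u) (hw : ∀ x, HasGradientAt u (w x) x)
    (hwc : Continuous w) (hodd : ∀ x, u (-x) = -u x) :
    ENNReal.ofReal (hardyConstOdd (finrank ℝ E) p) * ∫⁻ x, ENNReal.ofReal (|u x| ^ p / ‖x‖ ^ p) ≤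
      ∫⁻ x, ENNReal.ofReal (‖w x‖ ^ p) := by
  have hd := Module.finrank_pos (R := ℝ) (M := E)
  have hp0 : 0 < p := by linarith
  set C : ℝ := ((finrank ℝ E - p) / 2) ^ 2 + (finrank ℝ E - 1) with hC
  have hC0 : 0 < C := hardyConstOdd_base_pos hd hp
  -- Chosen so that (p/2)² m = C: the factor C then cancels on both sides after Young's inequality.
  set m : ℝ := C * (4 / p ^ 2) with hm
  have hm0 : 0 < m := by positivity
  have hu0 : u 0 = 0 := by
    have := hodd 0
    rw [neg_zero] at this
    linarith
  have hI := integrable_rpow_div_norm_rpow hp hu hus hu0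
  have hw0 : HasCompactSupport w := by
    refine hus.fderiv (𝕜 := ℝ) |>.mono fun x hx h0 ↦ hx ?_
    have := (hw x).hasFDerivAt.fderiv
    rw [h0] at this
    exact (map_eq_zero_iff _ (InnerProductSpace.toDual ℝ E).injective).1 this.symm
  have hG : Integrable fun x ↦ ‖w x‖ ^ p := by
    refine Continuous.integrable_of_hasCompactSupport
      (hwc.norm.rpow_const fun _ ↦ Or.inr hp0.le) (hw0.mono fun x hx h0 ↦ hx ?_)
    simp [h0, Real.zero_rpow hp0.ne']
  have hYoung : ∀ x, (p / 2) ^ 2 * (|u x| / ‖x‖) ^ (p - 2) * ‖w x‖ ^ 2 ≤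
      C * (2 / p * (‖w x‖ ^ p / m ^ (p / 2)) + (1 - 2 / p) * (|u x| ^ p / ‖x‖ ^ p)) := fun x ↦ by
    have h := sq_mul_rpow_sub_two_le hp hm0 (norm_nonneg (w x))
      (div_nonneg (abs_nonneg (u x)) (norm_nonneg x))
    rw [Real.div_rpow (abs_nonneg (u x)) (norm_nonneg x) p] at h
    have h' := mul_le_mul_of_nonneg_left h (sq_nonneg (p / 2))
    have e : (p / 2) ^ 2 * m = C := by rw [hm]; field_simp; norm_num
    rw [← mul_assoc _ m, e] at h'
    linarith
  have hq := (quadratic_hardy_odd hp hu hus hw hwc hodd).trans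
    (lintegral_mono fun x ↦ ENNReal.ofReal_le_ofReal (hYoung x))
  have hpos : 0 ≤ 1 - 2 / p := by rw [sub_nonneg, div_le_one hp0]; exact hp
  have hsum : Integrable fun x ↦
      C * (2 / p * (‖w x‖ ^ p / m ^ (p / 2)) + (1 - 2 / p) * (|u x| ^ p / ‖x‖ ^ p)) :=
    (((hG.div_const _).const_mul _).add (hI.const_mul _)).const_mul C
  rw [← ofReal_integral_eq_lintegral_ofReal (hI.const_mul C)
      (ae_of_all _ fun x ↦ by positivity),
    ← ofReal_integral_eq_lintegral_ofReal hsum (ae_of_all _ fun x ↦ by positivity),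
    ENNReal.ofReal_le_ofReal_iff (integral_nonneg fun x ↦ by positivity),
    integral_const_mul, integral_const_mul,
    integral_add ((hG.div_const _).const_mul _) (hI.const_mul _), integral_const_mul,
    integral_const_mul, integral_div, mul_le_mul_iff_right₀ hC0] at hq
  have hD : hardyConstOdd (finrank ℝ E) p = m ^ (p / 2) := hardyConstOdd_eq hp
  have hD0 : 0 < m ^ (p / 2) := by positivity
  rw [← ofReal_integral_eq_lintegral_ofReal hI (ae_of_all _ fun x ↦ by positivity),
    ← ofReal_integral_eq_lintegral_ofReal hG (ae_of_all _ fun x ↦ by positivity), hD,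
    ← ENNReal.ofReal_mul hD0.le]
  refine ENNReal.ofReal_le_ofReal ?_
  -- The Young remainder, 1 - 2/p times the Hardy integral, is absorbed on the left; this needs the
  -- finiteness in `hI`.
  have h2 : 2 / p * ∫ x, |u x| ^ p / ‖x‖ ^ p ≤ 2 / p * ((∫ x, ‖w x‖ ^ p) / m ^ (p / 2)) := by
    linarith
  have h3 := le_of_mul_le_mul_left h2 (by positivity)
  rw [le_div_iff₀ hD0] at h3
  linarith

end SmoothHardy

/-! ### Mollification of functions and weak gradients -/

section Mollification

open Set Filter Topology Module ContinuousLinearMap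
open scoped ENNReal Convolution

/-- Jensen's inequality for a power of an average. -/
theorem lintegral_rpow_le_lintegral_rpow {α : Type*} [MeasurableSpace α] (ν : Measure α)
    [IsProbabilityMeasure ν] {p : ℝ} (hp : 1 ≤ p) {g : α → ℝ≥0∞} (hg : AEMeasurable g ν) :
    (∫⁻ x, g x ∂ν) ^ p ≤ ∫⁻ x, g x ^ p ∂ν := by
  rcases hp.eq_or_lt with rfl | hp
  · simp
  have h := ENNReal.lintegral_mul_le_Lp_mul_Lq ν (Real.HolderConjugate.conjExponent hp) hg
    (aemeasurable_const (b := (1 : ℝ≥0∞)))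
  simp only [Pi.mul_apply, mul_one, ENNReal.one_rpow, lintegral_const, measure_univ] at h
  have h' := ENNReal.rpow_le_rpow h (by linarith : 0 ≤ p)
  rwa [← ENNReal.rpow_mul, one_div_mul_cancel (by linarith), ENNReal.rpow_one] at h'

variable {E : Type*} [NormedAddCommGroup E] [InnerProductSpace ℝ E] [FiniteDimensional ℝ E]
  [MeasurableSpace E] [BorelSpace E]
  {F : Type*} [NormedAddCommGroup F] [NormedSpace ℝ F]

/-- Averaging against a probability density does not increase `Lᵖ` norms. -/
theorem eLpNorm_convolution_le {p : ℝ} (hp : 1 ≤ p) {ρ : E → ℝ} (hρ : Continuous ρ)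
    (hρ0 : ∀ x, 0 ≤ ρ x) (hρi : Integrable ρ) (hρ1 : ∫ x, ρ x = 1) {f : E → F}
    (hf : AEStronglyMeasurable f) :
    eLpNorm (ρ ⋆[lsmul ℝ ℝ, volume] f) (ENNReal.ofReal p) volume ≤
      eLpNorm f (ENNReal.ofReal p) volume := by
  have hp0 : 0 < p := by linarith
  -- A strongly measurable representative makes (x, t) ↦ g(x - t) jointly measurable, as Tonelli
  -- requires.
  rw [convolution_congr (lsmul ℝ ℝ) (ae_eq_refl ρ) hf.ae_eq_mk, eLpNorm_congr_ae hf.ae_eq_mk]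
  set g := hf.mk f
  have hg : StronglyMeasurable g := hf.stronglyMeasurable_mk
  have hp1 : ENNReal.ofReal p ≠ 0 := by simpa using hp0
  rw [eLpNorm_eq_lintegral_rpow_enorm_toReal hp1 ENNReal.ofReal_ne_top,
    eLpNorm_eq_lintegral_rpow_enorm_toReal hp1 ENNReal.ofReal_ne_top,
    ENNReal.toReal_ofReal hp0.le]
  refine ENNReal.rpow_le_rpow ?_ (by positivity)
  set ν := volume.withDensity fun t ↦ ENNReal.ofReal (ρ t) with hν
  have hνp : IsProbabilityMeasure ν := by
    refine ⟨?_⟩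
    rw [withDensity_apply _ MeasurableSet.univ, setLIntegral_univ,
      ← ofReal_integral_eq_lintegral_ofReal hρi (ae_of_all _ hρ0), hρ1, ENNReal.ofReal_one]
  have hge : Measurable fun x ↦ ‖g x‖ₑ := hg.enorm
  have hρm := hρ.measurable
  have hpt : ∀ x, ‖(ρ ⋆[lsmul ℝ ℝ, volume] g) x‖ₑ ^ p ≤ ∫⁻ t, ‖g (x - t)‖ₑ ^ p ∂ν := fun x ↦ by
    have hgx : Measurable fun t ↦ ‖g (x - t)‖ₑ := hge.comp (measurable_const.sub measurable_id)
    refine le_trans (ENNReal.rpow_le_rpow ?_ hp0.le) (lintegral_rpow_le_lintegral_rpow ν hp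
      (g := fun t ↦ ‖g (x - t)‖ₑ) hgx.aemeasurable)
    rw [convolution_lsmul]
    refine (enorm_integral_le_lintegral_enorm _).trans (le_of_eq ?_)
    rw [hν, lintegral_withDensity_eq_lintegral_mul _ (by fun_prop) hgx]
    refine lintegral_congr fun t ↦ ?_
    rw [enorm_smul, Real.enorm_of_nonneg (hρ0 t)]
    rfl
  refine (lintegral_mono hpt).trans (le_of_eq ?_)
  have hm : Measurable fun q : E × E ↦ ‖g (q.1 - q.2)‖ₑ ^ p := by fun_prop
  rw [lintegral_lintegral_swap hm.aemeasurable]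
  have : ∀ t, ∫⁻ x, ‖g (x - t)‖ₑ ^ p = ∫⁻ x, ‖g x‖ₑ ^ p := fun t ↦
    lintegral_sub_right_eq_self (fun x ↦ ‖g x‖ₑ ^ p) t
  simp [this]

theorem convolution_odd {ρ : E → ℝ} (hρ : ∀ x, ρ (-x) = ρ x) {u : E → ℝ}
    (hu : ∀ᵐ x, u (-x) = -u x) (x : E) :
    (ρ ⋆[lsmul ℝ ℝ, volume] u) (-x) = -(ρ ⋆[lsmul ℝ ℝ, volume] u) x := by
  rw [convolution_lsmul_swap, convolution_lsmul_swap, ← integral_neg,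
    ← integral_neg_eq_self]
  refine integral_congr_ae (hu.mono fun t ht ↦ ?_)
  simp only [ht, smul_eq_mul, mul_neg, ← hρ (x - t)]
  congr 3
  abel

/-- Differentiation falls on ρ, and t ↦ ρ(x - t) is a test function for the weak gradient. The sign
from reflecting t cancels the one from integration by parts. -/
theorem hasGradientAt_convolution {d : ℕ} {u : EuclideanSpace ℝ (Fin d) → ℝ}
    {G : EuclideanSpace ℝ (Fin d) → EuclideanSpace ℝ (Fin d)} (hG : HasWeakGradient u G)
    {ρ : EuclideanSpace ℝ (Fin d) → ℝ} (hρ : ContDiff ℝ (⊤ : ℕ∞) ρ) (hρs : HasCompactSupport ρ)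
    (x : EuclideanSpace ℝ (Fin d)) :
    HasGradientAt (ρ ⋆[lsmul ℝ ℝ, volume] u) ((ρ ⋆[lsmul ℝ ℝ, volume] G) x) x := by
  have hρ1 : ContDiff ℝ 1 ρ := hρ.of_le (by simp)
  have h := hρs.hasFDerivAt_convolution_left (lsmul ℝ ℝ) hρ1 hG.locallyIntegrable x
  rw [hasGradientAt_iff_hasFDerivAt]
  refine h.congr_fderiv ?_
  apply ContinuousLinearMap.coe_injective
  refine (EuclideanSpace.basisFun (Fin d) ℝ).toBasis.ext fun i ↦ ?_
  simp only [OrthonormalBasis.coe_toBasis, EuclideanSpace.basisFun_apply,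
    ContinuousLinearMap.coe_coe, InnerProductSpace.toDual_apply_apply]
  have hint : Integrable fun t ↦ ρ (x - t) • G t := by
    have h1 := hρs.convolutionExists_left (lsmul ℝ ℝ) hρ.continuous hG.locallyIntegrable_gradient x
    have := h1.integrable_swap
    simpa using this
  have e1 : inner ℝ ((ρ ⋆[lsmul ℝ ℝ, volume] G) x) (EuclideanSpace.single i (1 : ℝ)) =
      ∫ t, G t i * ρ (x - t) := by
    rw [convolution_lsmul_swap, real_inner_comm, ← integral_inner hint]
    refine integral_congr_ae (ae_of_all _ fun t ↦ ?_)
    simp [EuclideanSpace.inner_single_left, mul_comm]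
  have hint' : Integrable fun t ↦ (lsmul ℝ ℝ).precompL (EuclideanSpace ℝ (Fin d))
      (fderiv ℝ ρ (x - t)) (u t) :=
    ((hρs.fderiv ℝ).convolutionExists_left _ (hρ1.continuous_fderiv one_ne_zero)
      hG.locallyIntegrable x).integrable_swap
  have hφ : ContDiff ℝ (⊤ : ℕ∞) fun t ↦ ρ (x - t) := hρ.comp (contDiff_const.sub contDiff_id)
  have hφs : HasCompactSupport fun t ↦ ρ (x - t) :=
    hρs.comp_homeomorph (Homeomorph.subLeft x)
  have hw := hG.integral_eq _ hφ hφs i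
  have hfd : ∀ t, fderiv ℝ (fun t ↦ ρ (x - t)) t (EuclideanSpace.single i 1) =
      -fderiv ℝ ρ (x - t) (EuclideanSpace.single i 1) := fun t ↦ by
    have := ((hρ1.differentiable one_ne_zero) (x - t)).hasFDerivAt.comp t
      ((hasFDerivAt_const x t).sub (hasFDerivAt_id t))
    rw [show (fun t ↦ ρ (x - t)) = ρ ∘ fun t ↦ x - t from rfl]
    rw [HasFDerivAt.fderiv this]
    simp
  rw [e1, convolution_eq_swap, ContinuousLinearMap.integral_apply hint']
  simp_rw [hfd, mul_neg, integral_neg, neg_inj] at hw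
  rw [← hw]
  refine integral_congr_ae (ae_of_all _ fun t ↦ ?_)
  simp [precompL_apply, mul_comm]

end Mollification

/-! ### Passage to odd Sobolev functions -/

section Approximation

open Set Filter Topology Module ContinuousLinearMap
open scoped ENNReal Convolution

/-- Weak gradients are unique almost everywhere. -/
theorem HasWeakGradient.ae_eq {d : ℕ} {u : EuclideanSpace ℝ (Fin d) → ℝ}
    {G H : EuclideanSpace ℝ (Fin d) → EuclideanSpace ℝ (Fin d)} (hG : HasWeakGradient u G)
    (hH : HasWeakGradient u H) : G =ᵐ[volume] H := by
  have key : ∀ i : Fin d, ∀ᵐ x : EuclideanSpace ℝ (Fin d), G x i = H x i := fun i ↦ by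
    have hl : ∀ {K : EuclideanSpace ℝ (Fin d) → EuclideanSpace ℝ (Fin d)},
        LocallyIntegrable K → LocallyIntegrable fun x ↦ K x i := fun hK x ↦ by
      obtain ⟨s, hs, hKs⟩ := hK x
      exact ⟨s, hs, (EuclideanSpace.proj (𝕜 := ℝ) i).integrable_comp hKs⟩
    refine ae_eq_of_integral_contDiff_smul_eq (hl hG.locallyIntegrable_gradient)
      (hl hH.locallyIntegrable_gradient) fun φ hφ hφs ↦ ?_
    have h := (hG.integral_eq φ hφ hφs i).symm.trans (hH.integral_eq φ hφ hφs i)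
    simpa [mul_comm] using h
  filter_upwards [ae_all_iff.2 key] with x hx
  ext i
  exact hx i

theorem lintegral_ofReal_norm_rpow {α F : Type*} [MeasurableSpace α] {μ : Measure α}
    [NormedAddCommGroup F] {p : ℝ} (hp : 0 < p) (f : α → F) :
    ∫⁻ x, ENNReal.ofReal (‖f x‖ ^ p) ∂μ = eLpNorm f (ENNReal.ofReal p) μ ^ p := by
  rw [eLpNorm_eq_lintegral_rpow_enorm_toReal (by simpa using hp) ENNReal.ofReal_ne_top,
    ENNReal.toReal_ofReal hp.le, ← ENNReal.rpow_mul, one_div_mul_cancel hp.ne', ENNReal.rpow_one]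
  refine lintegral_congr fun x ↦ ?_
  rw [← ENNReal.ofReal_rpow_of_nonneg (norm_nonneg _) hp.le, ofReal_norm]

/-- A smooth even cutoff function equal to `1` near the origin. -/
noncomputable def cutoffBump (E : Type*) [NormedAddCommGroup E] [InnerProductSpace ℝ E] :
    ContDiffBump (0 : E) := ⟨1, 2, one_pos, one_lt_two⟩

theorem hasGradientAt_cutoff_mul {E : Type*} [NormedAddCommGroup E] [InnerProductSpace ℝ E]
    [FiniteDimensional ℝ E] (ε : ℝ) {v : E → ℝ} {W : E → E} {x : E}
    (hv : HasGradientAt v (W x) x) :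
    HasGradientAt (fun x ↦ cutoffBump E (ε • x) * v x)
      (cutoffBump E (ε • x) • W x + (v x * ε) • gradient (cutoffBump E) (ε • x)) x := by
  have h1 : HasGradientAt (cutoffBump E) (gradient (cutoffBump E) (ε • x)) (ε • x) :=
    ((cutoffBump E).contDiff (n := 1) |>.differentiable one_ne_zero _).hasGradientAt
  rw [hasGradientAt_iff_hasFDerivAt] at *
  have h2 := h1.comp x ((hasFDerivAt_id x).const_smul ε)
  refine (h2.mul hv).congr_fderiv ?_
  ext y
  simp
  ring

theorem exists_norm_gradient_cutoff_le (E : Type*) [NormedAddCommGroup E] [InnerProductSpace ℝ E]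
    [FiniteDimensional ℝ E] : ∃ K : ℝ, ∀ x, ‖gradient (cutoffBump E) x‖ ≤ K := by
  obtain ⟨L, hL⟩ := ((cutoffBump E).contDiff (n := 1)).lipschitzWith_of_hasCompactSupport
    (cutoffBump E).hasCompactSupport one_ne_zero
  refine ⟨L, fun x ↦ ?_⟩
  rw [gradient, LinearIsometryEquiv.norm_map]
  exact norm_fderiv_le_of_lipschitz ℝ hL

theorem continuous_gradient_of_contDiff {E : Type*} [NormedAddCommGroup E] [InnerProductSpace ℝ E]
    [CompleteSpace E] {f : E → ℝ} (hf : ContDiff ℝ 1 f) : Continuous (gradient f) :=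
  (InnerProductSpace.toDual ℝ E).symm.continuous.comp (hf.continuous_fderiv one_ne_zero)

variable {d : ℕ}

/-- The Hardy inequality for a mollified and truncated odd Sobolev function. -/
theorem hardy_odd_cutoff_convolution (hd : 1 ≤ d) {p : ℝ} (hp : 2 ≤ p)
    {u : EuclideanSpace ℝ (Fin d) → ℝ} {G : EuclideanSpace ℝ (Fin d) → EuclideanSpace ℝ (Fin d)}
    (hG : HasWeakGradient u G) (hodd : ∀ᵐ x, u (-x) = -u x) {K : ℝ}
    (hK : ∀ x, ‖gradient (cutoffBump (EuclideanSpace ℝ (Fin d))) x‖ ≤ K) {ε : ℝ} (hε : 0 < ε)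
    (φ : ContDiffBump (0 : EuclideanSpace ℝ (Fin d))) :
    ENNReal.ofReal (hardyConstOdd d p) * ∫⁻ x, ENNReal.ofReal
        (|cutoffBump (EuclideanSpace ℝ (Fin d)) (ε • x) *
          (φ.normed volume ⋆[lsmul ℝ ℝ, volume] u) x| ^ p / ‖x‖ ^ p) ≤
      (eLpNorm G (ENNReal.ofReal p) volume +
        ENNReal.ofReal (ε * K) * eLpNorm u (ENNReal.ofReal p) volume) ^ p := by
  have : Nonempty (Fin d) := ⟨⟨0, hd⟩⟩
  have hp0 : 0 < p := by linarith
  set ρ := φ.normed (volume : Measure (EuclideanSpace ℝ (Fin d))) with hρ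
  have hρc : ContDiff ℝ (⊤ : ℕ∞) ρ := φ.contDiff_normed
  have hρs : HasCompactSupport ρ := φ.hasCompactSupport_normed
  set v := ρ ⋆[lsmul ℝ ℝ, volume] u with hv
  set W := ρ ⋆[lsmul ℝ ℝ, volume] G with hW
  set χ := cutoffBump (EuclideanSpace ℝ (Fin d)) with hχ
  have hvc : ContDiff ℝ 1 v :=
    hρs.contDiff_convolution_left (n := 1) _ (hρc.of_le (by simp)) hG.locallyIntegrable
  have hWc : Continuous W :=
    hρs.continuous_convolution_left _ hρc.continuous hG.locallyIntegrable_gradient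
  have hχc : ContDiff ℝ 1 χ := χ.contDiff
  have hgχ : Continuous (gradient χ) := continuous_gradient_of_contDiff hχc
  have hχ' := χ.continuous
  have hχs : HasCompactSupport fun x ↦ χ (ε • x) := χ.hasCompactSupport.comp_smul hε.ne'
  have hvc' := hvc.continuous
  have h := hardy_odd_of_contDiff hp (u := fun x ↦ χ (ε • x) * v x)
    (w := fun x ↦ χ (ε • x) • W x + (v x * ε) • gradient χ (ε • x))
    ((hχc.comp (contDiff_const_smul ε)).mul hvc) hχs.mul_right
    (fun x ↦ hasGradientAt_cutoff_mul ε (hasGradientAt_convolution hG hρc hρs x))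
    (by fun_prop)
    (fun x ↦ by
      rw [smul_neg, χ.neg, show v (-x) = -v x from convolution_odd φ.normed_neg hodd x, mul_neg])
  rw [finrank_euclideanSpace_fin, lintegral_ofReal_norm_rpow hp0] at h
  refine h.trans (ENNReal.rpow_le_rpow ?_ hp0.le)
  have hp1 : 1 ≤ p := by linarith
  have hWn : eLpNorm W (ENNReal.ofReal p) volume ≤ eLpNorm G (ENNReal.ofReal p) volume :=
    eLpNorm_convolution_le hp1 hρc.continuous φ.nonneg_normed φ.integrable_normed
      φ.integral_normed hG.locallyIntegrable_gradient.aestronglyMeasurable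
  have hvn : eLpNorm v (ENNReal.ofReal p) volume ≤ eLpNorm u (ENNReal.ofReal p) volume :=
    eLpNorm_convolution_le hp1 hρc.continuous φ.nonneg_normed φ.integrable_normed
      φ.integral_normed hG.locallyIntegrable.aestronglyMeasurable
  refine (eLpNorm_add_le (by fun_prop) (by fun_prop)
    (ENNReal.one_le_ofReal.2 hp1)).trans (add_le_add ?_ ?_)
  · refine (eLpNorm_mono fun x ↦ ?_).trans hWn
    rw [norm_smul, Real.norm_of_nonneg χ.nonneg]
    exact mul_le_of_le_one_left (norm_nonneg _) χ.le_one
  · refine (eLpNorm_le_mul_eLpNorm_of_ae_le_mul (g := v) (c := ε * K)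
      (ae_of_all _ fun x ↦ ?_) _).trans ?_
    · rw [norm_smul, norm_mul, Real.norm_of_nonneg hε.le, mul_assoc, mul_comm ‖v x‖]
      gcongr
      exact hK _
    · gcongr

/-- The sharp Hardy inequality for odd Sobolev functions, for extended nonnegative integrals. -/
theorem hardy_odd_lintegral (hd : 1 ≤ d) {p : ℝ} (hp : 2 ≤ p)
    {u : EuclideanSpace ℝ (Fin d) → ℝ} {G : EuclideanSpace ℝ (Fin d) → EuclideanSpace ℝ (Fin d)}
    (hG : HasWeakGradient u G) (hodd : ∀ᵐ x, u (-x) = -u x)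
    (hu : MemLp u (ENNReal.ofReal p)) :
    ENNReal.ofReal (hardyConstOdd d p) * ∫⁻ x, ENNReal.ofReal (|u x| ^ p / ‖x‖ ^ p) ≤
      ∫⁻ x, ENNReal.ofReal (‖G x‖ ^ p) := by
  have hp0 : 0 < p := by linarith
  obtain ⟨K, hK⟩ := exists_norm_gradient_cutoff_le (EuclideanSpace ℝ (Fin d))
  set ε : ℕ → ℝ := fun n ↦ 1 / ((n : ℝ) + 1) with hε
  have hε0 : ∀ n, 0 < ε n := fun n ↦ by positivity
  have hεlim : Tendsto ε atTop (𝓝 0) := tendsto_one_div_add_atTop_nhds_zero_nat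
  -- The ratio of outer to inner radius stays equal to 2, as almost everywhere convergence for
  -- merely locally integrable `u` requires.
  set φ : ℕ → ContDiffBump (0 : EuclideanSpace ℝ (Fin d)) := fun n ↦
    ⟨ε n, 2 * ε n, hε0 n, by linarith [hε0 n]⟩ with hφ
  set χ := cutoffBump (EuclideanSpace ℝ (Fin d)) with hχ
  set U : ℕ → EuclideanSpace ℝ (Fin d) → ℝ := fun n x ↦
    χ (ε n • x) * ((φ n).normed volume ⋆[lsmul ℝ ℝ, volume] u) x with hU
  have hbound := fun n ↦ hardy_odd_cutoff_convolution hd hp hG hodd hK (hε0 n) (φ n)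
  have hUm : ∀ n, Measurable (U n) := fun n ↦ by
    have h1 : Continuous ((φ n).normed volume ⋆[lsmul ℝ ℝ, volume] u) :=
      (φ n).hasCompactSupport_normed.continuous_convolution_left _ (φ n).continuous_normed
        hG.locallyIntegrable
    have h2 := χ.continuous
    exact Continuous.measurable (by fun_prop)
  have hlim : ∀ᵐ x, Tendsto (fun n ↦ U n x) atTop (𝓝 (u x)) := by
    have h := ContDiffBump.ae_convolution_tendsto_right_of_locallyIntegrable
      (μ := (volume : Measure (EuclideanSpace ℝ (Fin d)))) (φ := φ) (l := atTop) (K := 2)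
      (by simpa using hεlim.const_mul 2) (Eventually.of_forall fun n ↦ le_rfl) hG.locallyIntegrable
    filter_upwards [h] with x hx
    have hx0 : Tendsto (fun n ↦ ε n • x) atTop (𝓝 0) := by
      simpa using hεlim.smul_const x
    have hχ1 : Tendsto (fun n ↦ χ (ε n • x)) atTop (𝓝 1) := by
      have := (χ.continuous.tendsto 0).comp hx0
      rwa [χ.one_of_mem_closedBall (Metric.mem_closedBall_self χ.rIn_pos.le)] at this
    simpa using hχ1.mul hx
  have hfatou : ∫⁻ x, ENNReal.ofReal (|u x| ^ p / ‖x‖ ^ p) ≤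
      liminf (fun n ↦ ∫⁻ x, ENNReal.ofReal (|U n x| ^ p / ‖x‖ ^ p)) atTop := by
    refine le_trans (le_of_eq ?_) (lintegral_liminf_le fun n ↦ ?_)
    · refine lintegral_congr_ae (hlim.mono fun x hx ↦ ?_)
      refine (Tendsto.liminf_eq (ENNReal.tendsto_ofReal ?_)).symm
      exact (hx.abs.rpow_const (Or.inr hp0.le)).div_const _
    · have := hUm n
      fun_prop
  -- The error from differentiating the cutoff carries a factor ε and disappears because u lies in
  -- L^p.
  have hrhs : Tendsto (fun n ↦ (eLpNorm G (ENNReal.ofReal p) volume +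
      ENNReal.ofReal (ε n * K) * eLpNorm u (ENNReal.ofReal p) volume) ^ p) atTop
      (𝓝 (eLpNorm G (ENNReal.ofReal p) volume ^ p)) := by
    refine (ENNReal.continuous_rpow_const.tendsto _).comp ?_
    have h1 : Tendsto (fun n ↦ ENNReal.ofReal (ε n * K)) atTop (𝓝 0) := by
      simpa using ENNReal.tendsto_ofReal (hεlim.mul_const K)
    simpa using tendsto_const_nhds.add (ENNReal.Tendsto.mul_const h1 (Or.inr hu.2.ne))
  have hD := hardyConstOdd_pos hd hp
  have hD0 : ENNReal.ofReal (hardyConstOdd d p) ≠ 0 := by simpa using hD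
  rw [lintegral_ofReal_norm_rpow hp0, mul_comm,
    ← ENNReal.le_div_iff_mul_le (Or.inl hD0) (Or.inl ENNReal.ofReal_ne_top)]
  refine hfatou.trans ?_
  have hdiv := ENNReal.Tendsto.div_const hrhs (b := ENNReal.ofReal (hardyConstOdd d p))
    (Or.inr hD0)
  rw [← hdiv.liminf_eq]
  refine liminf_le_liminf (Eventually.of_forall fun n ↦ ?_)
  rw [ENNReal.le_div_iff_mul_le (Or.inl hD0) (Or.inl ENNReal.ofReal_ne_top), mul_comm]
  exact hbound n

end Approximation

/-! ### Integrability and the inequality for real integrals -/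

theorem theorem1p3 (d : ℕ) (hd : 1 ≤ d) (p : ℝ) (hp : 2 ≤ p)
    (u : EuclideanSpace ℝ (Fin d) → ℝ) (hu : MemOddSobolevW1 p u)
    (gradu : EuclideanSpace ℝ (Fin d) → EuclideanSpace ℝ (Fin d))
    (hgradu : HasWeakGradient u gradu) :
    Integrable (fun x => ‖gradu x‖ ^ p) volume ∧
    Integrable (fun x => |u x| ^ p / ‖x‖ ^ p) volume ∧
    (∫ x, ‖gradu x‖ ^ p) ≥ hardyConstOdd d p * (∫ x, |u x| ^ p / ‖x‖ ^ p) := by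
  obtain ⟨⟨hup, G, hG, hGp⟩, hodd⟩ := hu
  have hp0 : 0 < p := by linarith
  -- The given weak gradient is not assumed to lie in L^p; uniqueness identifies it with the one
  -- that does.
  have hgp : MemLp gradu (ENNReal.ofReal p) volume := hGp.ae_eq (hG.ae_eq hgradu)
  have hgi : Integrable (fun x => ‖gradu x‖ ^ p) volume := by
    have := hgp.integrable_norm_rpow (by simpa using hp0) ENNReal.ofReal_ne_top
    rwa [ENNReal.toReal_ofReal hp0.le] at this
  have hmain := hardy_odd_lintegral hd hp hgradu hodd hup
  have hD := hardyConstOdd_pos hd hp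
  rw [← ofReal_integral_eq_lintegral_ofReal hgi (ae_of_all _ fun x ↦ by positivity)] at hmain
  have hum : AEMeasurable (fun x ↦ |u x| ^ p / ‖x‖ ^ p) volume := by
    have := hup.1.aemeasurable
    fun_prop
  have hui : Integrable (fun x => |u x| ^ p / ‖x‖ ^ p) volume := by
    refine ⟨hum.aestronglyMeasurable, ?_⟩
    rw [hasFiniteIntegral_iff_ofReal (ae_of_all _ fun x ↦ by positivity)]
    refine lt_top_iff_ne_top.2 fun h ↦ ?_
    -- As the Hardy constant is strictly positive, an infinite Hardy integral would force an
    -- infinite gradient integral.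
    rw [h, ENNReal.mul_top (by simpa using hD)] at hmain
    exact ENNReal.ofReal_ne_top (top_le_iff.1 hmain)
  refine ⟨hgi, hui, ?_⟩
  rw [← ofReal_integral_eq_lintegral_ofReal hui (ae_of_all _ fun x ↦ by positivity),
    ← ENNReal.ofReal_mul hD.le,
    ENNReal.ofReal_le_ofReal_iff (integral_nonneg fun x ↦ by positivity)] at hmain
  exact hmain
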